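/- Let $G$ be a finite group acting by homeomorphisms on a compact Hausdorff space $X$, let $A$ be a unital Banach $\mathbb{R}$-algebra, and let $\mathcal{A}$ be a locally trivial bundle of Banach algebras on $X$ with fibers isomorphic to $A$, on which $G$ acts continuously and compatibly with its action on $X$, by algebra isomorphisms $\mathcal{A}_x\to\mathcal{A}_{gx}$. An $\mathcal{A}$-bundle is a locally trivial bundle $E$ of left $\mathcal{A}$-modules on $X$ such that $\mathcal{A}\times_X E\to E$ is continuous and each $E_x$ is a finitely generated projective $\mathcal{A}_x$-module; here local triviality means that locally on $X$ the pair $(\mathcal{A},E)$ is isomorphic to $(U\times A,\,U\times P)$ for some $A$-module $P$ with its canonical topology ($P$ may vary with the point). A $G$--$\mathcal{A}$ bundle is an $\mathcal{A}$-bundle $E$ with a continuous action of $G$ by additive maps $E_x\to E_{gx}$ such that $g(a\cdot e)=g(a)\cdot g(e)$ for $a\in\mathcal{A}_x$, $e\in E_x$; morphisms are the continuous $G$-equivariant bundle maps that are module maps on the fibers. Let $B=\Gamma(\mathcal{A})$ be the ring of continuous sections of $\mathcal{A}$, with the action $(gb)(x)=g(b(g^{-1}x))$, and let $B\rtimes G$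 be the twisted group ring, that is, the free left $B$-module on $G$ with $g\cdot b=g(b)\cdot g$. For each $G$--$\mathcal{A}$ bundle $E$, the group $\Gamma(E)$ of continuous sections is a left $B\rtimes G$-module by $((bg)s)(x)=b(x)\,g(s(g^{-1}x))$. This module is finitely generated and projective, and $\Gamma$ is an equivalence from the category of $G$--$\mathcal{A}$ bundles on $X$ to the category of finitely generated projective left $B\rtimes G$-modules. Consequently $[E]\mapsto[\Gamma(E)]$ defines an isomorphism $$K_G^{\mathcal{A}}(X)\;\cong\;K_0(B\rtimes G),$$ where $K_G^{\mathcal{A}}(X)$ is the Grothendieck group of the additive category of $G$--$\mathcal{A}$ bundles on $X$ (generated by the objects, with $[E\oplus F]=[E]+[F]$). -/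

import Mathlib

open CategoryTheory

universe u

namespace TwistedK

/-! ### Continuity of maps into a locally trivial bundle -/

section Trivialization

variable {X F Y : Type*} {E : X → Type*} [TopologicalSpace X] [TopologicalSpace F]
  [TopologicalSpace Y] [TopologicalSpace (Σ x, E x)]

theorem continuousAt_iff_snd (e : Bundle.Trivialization F (Sigma.fst : (Σ x, E x) → X))
    {s : Y → Σ x, E x} {y : Y} (hb : ContinuousAt (fun z => (s z).1) y)
    (hy : (s y).1 ∈ e.baseSet) :
    ContinuousAt s y ↔ ContinuousAt (fun z => (e (s z)).2) y := by
  have hsrc : s y ∈ e.source := e.mem_source.2 hy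
  constructor
  · intro h
    exact continuousAt_snd.comp
      ((e.toOpenPartialHomeomorph.continuousAt hsrc).comp_of_eq h rfl)
  · intro h
    have hev : ∀ᶠ z in nhds y, (s z).1 ∈ e.baseSet := hb (e.open_baseSet.mem_nhds hy)
    have h2 : ContinuousAt (fun z => ((s z).1, (e (s z)).2)) y := hb.prodMk h
    have h3 : ContinuousAt e.toOpenPartialHomeomorph.symm ((s y).1, (e (s y)).2) :=
      e.toOpenPartialHomeomorph.symm.continuousAt (e.mem_target.2 hy)
    refine (h3.comp_of_eq h2 rfl).congr ?_
    filter_upwards [hev] with z hz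
    have := e.symm_apply_mk_proj (e.mem_source.2 hz)
    exact this

end Trivialization

/-! ### Bundles of Banach algebras -/

/-- A local trivialization of a family of `ℝ`-algebras over `X`, with model `A`, that is an
algebra isomorphism on each fiber. -/
def IsAlgebraTrivialization {X A : Type u} {fiber : X → Type u} [TopologicalSpace X]
    [NormedRing A] [NormedAlgebra ℝ A] [∀ x, Ring (fiber x)] [∀ x, Algebra ℝ (fiber x)]
    [TopologicalSpace (Σ x, fiber x)]
    (e : Bundle.Trivialization A (Sigma.fst : (Σ x, fiber x) → X)) : Prop :=
  ∀ y ∈ e.baseSet, ∃ φ : fiber y ≃ₐ[ℝ] A, ∀ a : fiber y, (e ⟨y, a⟩).2 = φ a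

/-- A locally trivial bundle of (unital, real) Banach algebras on `X` with fibers isomorphic
to `A`, given by its fibers and the topology on its total space. -/
structure AlgebraBundle (X A : Type u) [TopologicalSpace X] [NormedRing A]
    [NormedAlgebra ℝ A] where
  fiber : X → Type u
  [ring : ∀ x, Ring (fiber x)]
  [algebra : ∀ x, Algebra ℝ (fiber x)]
  [topology : TopologicalSpace (Σ x, fiber x)]
  locally_trivial : ∀ x : X,
    ∃ e : Bundle.Trivialization A (Sigma.fst : (Σ x, fiber x) → X),
      x ∈ e.baseSet ∧ IsAlgebraTrivialization e

attribute [instance] AlgebraBundle.ring AlgebraBundle.algebra AlgebraBundle.topology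

/-- A bundle of Banach algebras on the `G`-space `X`, with an action of `G` by algebra
isomorphisms `act g : 𝒜_x ≃ 𝒜_{gx}`. The target point is written `y`, with a proof
of `g • x = y`. The group `G` is regarded as discrete. -/
structure GAlgebraBundle (G X A : Type u) [Group G] [TopologicalSpace X] [MulAction G X]
    [NormedRing A] [NormedAlgebra ℝ A] extends AlgebraBundle X A where
  act : ∀ (g : G) {x y : X}, g • x = y → (fiber x ≃ₐ[ℝ] fiber y)
  act_one : ∀ {x : X} (a : fiber x), act 1 (one_smul G x) a = a
  act_mul : ∀ (g h : G) {x y z : X} (hxy : h • x = y) (hyz : g • y = z) (a : fiber x),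
    act (g * h) (by rw [mul_smul, hxy, hyz]) a = act g hyz (act h hxy a)
  continuous_act : ∀ g : G, Continuous
    (fun p : Σ x, fiber x => (⟨g • p.1, act g rfl p.2⟩ : Σ x, fiber x))

/-! ### `𝒜`-bundles and `G`-`𝒜` bundles -/

/-- An `𝒜`-bundle: a locally trivial bundle of left `𝒜`-modules with continuous
multiplication `𝒜 ×_X E → E`, whose fibers are finitely generated projective.

Locally trivial means that near each point `𝒜` is isomorphic to the trivial bundle with
fiber `A`, and `E`, as a bundle of modules over it, to the trivial bundle with fiber some
`A`-module `P`. The topology of `P` is the module topology, that is the quotient topology from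
`A ^ n` when `P` is generated by `n` elements. The model `P` may depend on the point.

The topology on `Σ x, 𝒜_x × E_x` in `continuous_smul` is that of the fiber product
`𝒜 ×_X E`, a subspace of the product of the total spaces. -/
structure ModuleBundle {X A : Type u} [TopologicalSpace X] [NormedRing A] [NormedAlgebra ℝ A]
    (𝒜 : AlgebraBundle X A) where
  fiber : X → Type u
  [addCommGroup : ∀ x, AddCommGroup (fiber x)]
  [module : ∀ x, Module (𝒜.fiber x) (fiber x)]
  [topology : TopologicalSpace (Σ x, fiber x)]
  locally_trivial : ∀ x : X,
    ∃ (P : Type u) (_ : AddCommGroup P) (_ : Module A P) (_ : TopologicalSpace P)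
      (_ : IsModuleTopology A P)
      (eA : Bundle.Trivialization A (Sigma.fst : (Σ x, 𝒜.fiber x) → X))
      (e : Bundle.Trivialization P (Sigma.fst : (Σ x, fiber x) → X)),
      x ∈ eA.baseSet ∧ x ∈ e.baseSet ∧ IsAlgebraTrivialization eA ∧
      (∀ y ∈ e.baseSet, ∀ v w : fiber y,
        (e ⟨y, v + w⟩).2 = (e ⟨y, v⟩).2 + (e ⟨y, w⟩).2) ∧
      (∀ y ∈ eA.baseSet ∩ e.baseSet, ∀ (a : 𝒜.fiber y) (v : fiber y),
        (e ⟨y, a • v⟩).2 = (eA ⟨y, a⟩).2 • (e ⟨y, v⟩).2)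
  continuous_smul :
    @Continuous (Σ x, 𝒜.fiber x × fiber x) (Σ x, fiber x)
      (TopologicalSpace.induced
        (fun p => ((⟨p.1, p.2.1⟩, ⟨p.1, p.2.2⟩) : (Σ x, 𝒜.fiber x) × (Σ x, fiber x)))
        inferInstance)
      topology
      (fun p => ⟨p.1, p.2.1 • p.2.2⟩)
  finite_fiber : ∀ x, Module.Finite (𝒜.fiber x) (fiber x)
  projective_fiber : ∀ x, Module.Projective (𝒜.fiber x) (fiber x)

attribute [instance] ModuleBundle.addCommGroup ModuleBundle.module ModuleBundle.topology

/-- A `G`-`𝒜` bundle: an `𝒜`-bundle with an action of `G` by additive maps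
`act g : E_x → E_{gx}` such that `g (a e) = g(a) g(e)`. -/
structure GModuleBundle {G X A : Type u} [Group G] [TopologicalSpace X] [MulAction G X]
    [NormedRing A] [NormedAlgebra ℝ A] (𝒜 : GAlgebraBundle G X A)
    extends ModuleBundle 𝒜.toAlgebraBundle where
  act : ∀ (g : G) {x y : X}, g • x = y → (fiber x →+ fiber y)
  act_one : ∀ {x : X} (v : fiber x), act 1 (one_smul G x) v = v
  act_mul : ∀ (g h : G) {x y z : X} (hxy : h • x = y) (hyz : g • y = z) (v : fiber x),
    act (g * h) (by rw [mul_smul, hxy, hyz]) v = act g hyz (act h hxy v)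
  act_smul : ∀ (g : G) {x y : X} (h : g • x = y) (a : 𝒜.fiber x) (v : fiber x),
    act g h (a • v) = 𝒜.act g h a • act g h v
  continuous_act : ∀ g : G, Continuous
    (fun p : Σ x, fiber x => (⟨g • p.1, act g rfl p.2⟩ : Σ x, fiber x))

/-! ### Fiberwise operations are continuous -/

namespace AlgebraBundle

variable {X A Y : Type u} [TopologicalSpace X] [NormedRing A] [NormedAlgebra ℝ A]
  [TopologicalSpace Y] (𝒜 : AlgebraBundle X A)

theorem continuous_add {b : Y → X} (hb : Continuous b) {s t : ∀ y, 𝒜.fiber (b y)}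
    (hs : Continuous fun y => (⟨b y, s y⟩ : Σ x, 𝒜.fiber x))
    (ht : Continuous fun y => (⟨b y, t y⟩ : Σ x, 𝒜.fiber x)) :
    Continuous fun y => (⟨b y, s y + t y⟩ : Σ x, 𝒜.fiber x) := by
  refine continuous_iff_continuousAt.2 fun y => ?_
  obtain ⟨e, hx, he⟩ := 𝒜.locally_trivial (b y)
  have h1 := (continuousAt_iff_snd e hb.continuousAt hx).1 hs.continuousAt
  have h2 := (continuousAt_iff_snd e hb.continuousAt hx).1 ht.continuousAt
  refine (continuousAt_iff_snd e hb.continuousAt hx).2 ((h1.add h2).congr ?_)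
  filter_upwards [hb.continuousAt (e.open_baseSet.mem_nhds hx)] with z hz
  obtain ⟨φ, hφ⟩ := he (b z) hz
  simp [hφ]

theorem continuous_mul {b : Y → X} (hb : Continuous b) {s t : ∀ y, 𝒜.fiber (b y)}
    (hs : Continuous fun y => (⟨b y, s y⟩ : Σ x, 𝒜.fiber x))
    (ht : Continuous fun y => (⟨b y, t y⟩ : Σ x, 𝒜.fiber x)) :
    Continuous fun y => (⟨b y, s y * t y⟩ : Σ x, 𝒜.fiber x) := by
  refine continuous_iff_continuousAt.2 fun y => ?_
  obtain ⟨e, hx, he⟩ := 𝒜.locally_trivial (b y)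
  have h1 := (continuousAt_iff_snd e hb.continuousAt hx).1 hs.continuousAt
  have h2 := (continuousAt_iff_snd e hb.continuousAt hx).1 ht.continuousAt
  refine (continuousAt_iff_snd e hb.continuousAt hx).2 ((h1.mul h2).congr ?_)
  filter_upwards [hb.continuousAt (e.open_baseSet.mem_nhds hx)] with z hz
  obtain ⟨φ, hφ⟩ := he (b z) hz
  simp [hφ]

theorem continuous_algebraMap {b : Y → X} (hb : Continuous b) (r : ℝ) :
    Continuous fun y => (⟨b y, algebraMap ℝ (𝒜.fiber (b y)) r⟩ : Σ x, 𝒜.fiber x) := by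
  refine continuous_iff_continuousAt.2 fun y => ?_
  obtain ⟨e, hx, he⟩ := 𝒜.locally_trivial (b y)
  refine (continuousAt_iff_snd e hb.continuousAt hx).2
    ((continuousAt_const (y := algebraMap ℝ A r)).congr ?_)
  filter_upwards [hb.continuousAt (e.open_baseSet.mem_nhds hx)] with z hz
  obtain ⟨φ, hφ⟩ := he (b z) hz
  simp [hφ]

/-- The ring `B = Γ(𝒜)` of continuous sections of `𝒜`, with pointwise operations. -/
def sections : Subring (∀ x, 𝒜.fiber x) where
  carrier := {s | Continuous fun x => (⟨x, s x⟩ : Σ x, 𝒜.fiber x)}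
  add_mem' := fun hs ht => 𝒜.continuous_add continuous_id hs ht
  mul_mem' := fun hs ht => 𝒜.continuous_mul continuous_id hs ht
  zero_mem' := by simpa using 𝒜.continuous_algebraMap continuous_id 0
  one_mem' := by simpa using 𝒜.continuous_algebraMap continuous_id 1
  neg_mem' := fun {s} hs => by
    simpa using 𝒜.continuous_mul continuous_id (𝒜.continuous_algebraMap continuous_id (-1)) hs

end AlgebraBundle

namespace ModuleBundle

variable {X A Y : Type u} [TopologicalSpace X] [NormedRing A] [NormedAlgebra ℝ A]
  [TopologicalSpace Y] {𝒜 : AlgebraBundle X A} (E : ModuleBundle 𝒜)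

theorem continuous_fst : Continuous (Sigma.fst : (Σ x, E.fiber x) → X) := by
  refine continuous_iff_continuousAt.2 fun p => ?_
  obtain ⟨P, _, _, _, _, eA, e, -, hx, -⟩ := E.locally_trivial p.1
  exact e.continuousAt_proj (e.mem_source.2 hx)

theorem continuous_add {b : Y → X} (hb : Continuous b) {s t : ∀ y, E.fiber (b y)}
    (hs : Continuous fun y => (⟨b y, s y⟩ : Σ x, E.fiber x))
    (ht : Continuous fun y => (⟨b y, t y⟩ : Σ x, E.fiber x)) :
    Continuous fun y => (⟨b y, s y + t y⟩ : Σ x, E.fiber x) := by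
  refine continuous_iff_continuousAt.2 fun y => ?_
  obtain ⟨P, _, _, _, _, eA, e, -, hx, -, hadd, -⟩ := E.locally_trivial (b y)
  have := IsModuleTopology.toContinuousAdd A P
  have h1 := (continuousAt_iff_snd e hb.continuousAt hx).1 hs.continuousAt
  have h2 := (continuousAt_iff_snd e hb.continuousAt hx).1 ht.continuousAt
  refine (continuousAt_iff_snd e hb.continuousAt hx).2 ((h1.add h2).congr ?_)
  filter_upwards [hb.continuousAt (e.open_baseSet.mem_nhds hx)] with z hz
  exact (hadd _ hz _ _).symm

theorem continuous_zero {b : Y → X} (hb : Continuous b) :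
    Continuous fun y => (⟨b y, 0⟩ : Σ x, E.fiber x) := by
  refine continuous_iff_continuousAt.2 fun y => ?_
  obtain ⟨P, _, _, _, _, eA, e, -, hx, -, hadd, -⟩ := E.locally_trivial (b y)
  refine (continuousAt_iff_snd e hb.continuousAt hx).2
    ((continuousAt_const (y := (0 : P))).congr ?_)
  filter_upwards [hb.continuousAt (e.open_baseSet.mem_nhds hx)] with z hz
  have h := hadd _ hz 0 0
  rw [add_zero] at h
  exact (left_eq_add.1 h).symm

theorem continuous_smul' {b : Y → X} {a : ∀ y, 𝒜.fiber (b y)} {s : ∀ y, E.fiber (b y)}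
    (ha : Continuous fun y => (⟨b y, a y⟩ : Σ x, 𝒜.fiber x))
    (hs : Continuous fun y => (⟨b y, s y⟩ : Σ x, E.fiber x)) :
    Continuous fun y => (⟨b y, a y • s y⟩ : Σ x, E.fiber x) := by
  let _ : TopologicalSpace (Σ x, 𝒜.fiber x × E.fiber x) := TopologicalSpace.induced
    (fun p => ((⟨p.1, p.2.1⟩, ⟨p.1, p.2.2⟩) : (Σ x, 𝒜.fiber x) × (Σ x, E.fiber x)))
    inferInstance
  have h : Continuous fun y => (⟨b y, (a y, s y)⟩ : Σ x, 𝒜.fiber x × E.fiber x) :=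
    continuous_induced_rng.2 (ha.prodMk hs)
  exact E.continuous_smul.comp h

theorem continuous_neg {b : Y → X} (hb : Continuous b) {s : ∀ y, E.fiber (b y)}
    (hs : Continuous fun y => (⟨b y, s y⟩ : Σ x, E.fiber x)) :
    Continuous fun y => (⟨b y, - s y⟩ : Σ x, E.fiber x) := by
  simpa using E.continuous_smul' (𝒜.continuous_algebraMap hb (-1)) hs

/-- The group `Γ(E)` of continuous sections of `E`. -/
def sections : AddSubgroup (∀ x, E.fiber x) where
  carrier := {s | Continuous fun x => (⟨x, s x⟩ : Σ x, E.fiber x)}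
  add_mem' := fun hs ht => E.continuous_add continuous_id hs ht
  zero_mem' := E.continuous_zero continuous_id
  neg_mem' := fun hs => E.continuous_neg continuous_id hs

/-- `Γ(E)` is a module over `Γ(𝒜)` by `(b s)(x) = b(x) s(x)`. -/
instance : Module 𝒜.sections E.sections where
  smul b s := ⟨fun x => b.1 x • s.1 x, E.continuous_smul' b.2 s.2⟩
  one_smul s := Subtype.ext (funext fun x => one_smul _ (s.1 x))
  mul_smul b c s := Subtype.ext (funext fun x => mul_smul (b.1 x) (c.1 x) (s.1 x))
  smul_zero b := Subtype.ext (funext fun x => smul_zero (b.1 x))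
  smul_add b s t := Subtype.ext (funext fun x => smul_add (b.1 x) (s.1 x) (t.1 x))
  add_smul b c s := Subtype.ext (funext fun x => add_smul (b.1 x) (c.1 x) (s.1 x))
  zero_smul s := Subtype.ext (funext fun x => zero_smul _ (s.1 x))

@[simp]
theorem sections_smul_apply (b : 𝒜.sections) (s : E.sections) (x : X) :
    (b • s).1 x = b.1 x • s.1 x := rfl

end ModuleBundle

/-! ### The action of `G` on sections -/

section Action

variable {G X A : Type u} [Group G] [TopologicalSpace X] [MulAction G X]
  [NormedRing A] [NormedAlgebra ℝ A]

namespace GAlgebraBundle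

variable (𝒜 : GAlgebraBundle G X A)

theorem act_act {g h k : G} (hk : k = g * h) {x y z : X} (hxy : h • x = y) (hyz : g • y = z)
    (hxz : k • x = z) (a : 𝒜.fiber x) : 𝒜.act g hyz (𝒜.act h hxy a) = 𝒜.act k hxz a := by
  subst hk; exact (𝒜.act_mul g h hxy hyz a).symm

variable [ContinuousConstSMul G X]

theorem continuous_translate (g : G) {s : ∀ x, 𝒜.fiber x}
    (hs : Continuous fun x => (⟨x, s x⟩ : Σ x, 𝒜.fiber x)) :
    Continuous fun x =>
      (⟨x, 𝒜.act g (smul_inv_smul g x) (s (g⁻¹ • x))⟩ : Σ x, 𝒜.fiber x) := by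
  have h := (𝒜.continuous_act g).comp (hs.comp (continuous_const_smul g⁻¹))
  refine h.congr fun x => ?_
  have key : ∀ (y : X) (e : g • g⁻¹ • x = y),
      (⟨g • g⁻¹ • x, 𝒜.act g rfl (s (g⁻¹ • x))⟩ : Σ x, 𝒜.fiber x) =
        ⟨y, 𝒜.act g e (s (g⁻¹ • x))⟩ := by
    rintro _ rfl; rfl
  exact key x _

/-- `G` acts on `B = Γ(𝒜)` by `(g s)(x) = g (s (g⁻¹ x))`. -/
instance : MulSemiringAction G 𝒜.toAlgebraBundle.sections where
  smul g s := ⟨fun x => 𝒜.act g (smul_inv_smul g x) (s.1 (g⁻¹ • x)),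
    𝒜.continuous_translate g s.2⟩
  one_smul s := Subtype.ext (funext fun x => by
    have key : ∀ (y : X) (e : (1 : G) • y = x), 𝒜.act 1 e (s.1 y) = s.1 x := by
      intro y e
      obtain rfl : y = x := by rw [← e, one_smul]
      exact 𝒜.act_one _
    exact key _ _)
  mul_smul g h s := Subtype.ext (funext fun x => by
    have key : ∀ (y : X) (e : (g * h) • y = x) (w : X) (e₂ : h • w = g⁻¹ • x),
        𝒜.act (g * h) e (s.1 y) = 𝒜.act g (smul_inv_smul g x) (𝒜.act h e₂ (s.1 w)) := by
      intro y e w e₂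
      obtain rfl : y = w := by
        rw [eq_inv_smul_iff.2 e₂, ← e]; simp [mul_smul]
      exact (𝒜.act_act rfl _ _ _ _).symm
    exact key _ _ _ _)
  smul_zero g := Subtype.ext (funext fun x => map_zero (𝒜.act g (smul_inv_smul g x)))
  smul_add g s t := Subtype.ext (funext fun x => map_add (𝒜.act g (smul_inv_smul g x)) _ _)
  smul_one g := Subtype.ext (funext fun x => map_one (𝒜.act g (smul_inv_smul g x)))
  smul_mul g s t := Subtype.ext (funext fun x => map_mul (𝒜.act g (smul_inv_smul g x)) _ _)

/-- The twisted group ring `B ⋊ G` with `B = Γ(𝒜)`: the free left `B`-module on `G`, with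
the multiplication determined by `g * b = g(b) * g`. -/
abbrev crossedProduct : Type u := SkewMonoidAlgebra 𝒜.toAlgebraBundle.sections G

end GAlgebraBundle

namespace GModuleBundle

variable {𝒜 : GAlgebraBundle G X A} (E : GModuleBundle 𝒜)

theorem act_act {g h k : G} (hk : k = g * h) {x y z : X} (hxy : h • x = y) (hyz : g • y = z)
    (hxz : k • x = z) (a : E.fiber x) : E.act g hyz (E.act h hxy a) = E.act k hxz a := by
  subst hk; exact (E.act_mul g h hxy hyz a).symm

variable [ContinuousConstSMul G X]

theorem continuous_translate (g : G) {s : ∀ x, E.fiber x}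
    (hs : Continuous fun x => (⟨x, s x⟩ : Σ x, E.fiber x)) :
    Continuous fun x =>
      (⟨x, E.act g (smul_inv_smul g x) (s (g⁻¹ • x))⟩ : Σ x, E.fiber x) := by
  have h := (E.continuous_act g).comp (hs.comp (continuous_const_smul g⁻¹))
  refine h.congr fun x => ?_
  have key : ∀ (y : X) (e : g • g⁻¹ • x = y),
      (⟨g • g⁻¹ • x, E.act g rfl (s (g⁻¹ • x))⟩ : Σ x, E.fiber x) =
        ⟨y, E.act g e (s (g⁻¹ • x))⟩ := by
    rintro _ rfl; rfl
  exact key x _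

/-- `G` acts on `Γ(E)` by `(g s)(x) = g (s (g⁻¹ x))`. -/
instance : DistribMulAction G E.toModuleBundle.sections where
  smul g s := ⟨fun x => E.act g (smul_inv_smul g x) (s.1 (g⁻¹ • x)),
    E.continuous_translate g s.2⟩
  one_smul s := Subtype.ext (funext fun x => by
    have key : ∀ (y : X) (e : (1 : G) • y = x), E.act 1 e (s.1 y) = s.1 x := by
      intro y e
      obtain rfl : y = x := by rw [← e, one_smul]
      exact E.act_one _
    exact key _ _)
  mul_smul g h s := Subtype.ext (funext fun x => by
    have key : ∀ (y : X) (e : (g * h) • y = x) (w : X) (e₂ : h • w = g⁻¹ • x),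
        E.act (g * h) e (s.1 y) = E.act g (smul_inv_smul g x) (E.act h e₂ (s.1 w)) := by
      intro y e w e₂
      obtain rfl : y = w := by
        rw [eq_inv_smul_iff.2 e₂, ← e]; simp [mul_smul]
      exact (E.act_act rfl _ _ _ _).symm
    exact key _ _ _ _)
  smul_zero g := Subtype.ext (funext fun x => map_zero (E.act g (smul_inv_smul g x)))
  smul_add g s t := Subtype.ext (funext fun x => map_add (E.act g (smul_inv_smul g x)) _ _)

theorem smul_smul_sections (g : G) (b : 𝒜.toAlgebraBundle.sections)
    (s : E.toModuleBundle.sections) : g • (b • s) = (g • b) • (g • s) :=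
  Subtype.ext (funext fun x => E.act_smul g (smul_inv_smul g x) _ _)

/-- The ring homomorphism `B ⋊ G → End Γ(E)` sending `b g` to `s ↦ b (g s)`. -/
noncomputable def crossedProductHom :
    𝒜.crossedProduct →+* AddMonoid.End E.toModuleBundle.sections :=
  SkewMonoidAlgebra.liftNCRingHom
    (Module.toAddMonoidEnd 𝒜.toAlgebraBundle.sections E.toModuleBundle.sections)
    (DistribMulAction.toAddMonoidEnd G E.toModuleBundle.sections)
    (fun {b g} => AddMonoidHom.ext fun s => (E.smul_smul_sections g b s).symm)

/-- `Γ(E)` is a left `B ⋊ G`-module, by `(b g) s = b (g s)`. -/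
noncomputable instance : Module 𝒜.crossedProduct E.toModuleBundle.sections :=
  Module.compHom _ E.crossedProductHom

theorem single_smul (g : G) (b : 𝒜.toAlgebraBundle.sections) (s : E.toModuleBundle.sections) :
    (SkewMonoidAlgebra.single g b : 𝒜.crossedProduct) • s = b • (g • s) := by
  change E.crossedProductHom (SkewMonoidAlgebra.single g b) s = _
  have := SkewMonoidAlgebra.liftNC_single
    ((Module.toAddMonoidEnd 𝒜.toAlgebraBundle.sections E.toModuleBundle.sections :
      _ →+* AddMonoid.End E.toModuleBundle.sections) : _ →+ _)
    (DistribMulAction.toAddMonoidEnd G E.toModuleBundle.sections) g b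
  exact DFunLike.congr_fun this s

end GModuleBundle

end Action

/-! ### The category of `G`-`𝒜` bundles -/

section Category

variable {G X A : Type u} [Group G] [TopologicalSpace X] [MulAction G X]
  [NormedRing A] [NormedAlgebra ℝ A] {𝒜 : GAlgebraBundle G X A}

namespace GModuleBundle

/-- Morphisms of `G`-`𝒜` bundles: continuous `G`-equivariant bundle maps whose fibers are
module maps. -/
@[ext]
structure Hom (E F : GModuleBundle 𝒜) where
  app : ∀ x, E.fiber x →ₗ[𝒜.fiber x] F.fiber x
  continuous_app : Continuous
    (fun p : Σ x, E.fiber x => (⟨p.1, app p.1 p.2⟩ : Σ x, F.fiber x))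
  equivariant : ∀ (g : G) {x y : X} (h : g • x = y) (v : E.fiber x),
    app y (E.act g h v) = F.act g h (app x v)

instance : Category (GModuleBundle 𝒜) where
  Hom := Hom
  id E := ⟨fun _ => LinearMap.id, continuous_id, fun _ _ _ _ _ => rfl⟩
  comp f g := ⟨fun x => (g.app x).comp (f.app x), g.continuous_app.comp f.continuous_app,
    fun k _ _ h v => by simp [f.equivariant k h, g.equivariant k h]⟩

variable {E F : GModuleBundle 𝒜}

instance : Zero (E ⟶ F) :=
  ⟨⟨fun _ => 0, F.continuous_zero E.continuous_fst, fun g _ _ h _ => (map_zero (F.act g h)).symm⟩⟩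

instance : Add (E ⟶ F) :=
  ⟨fun f f' => ⟨fun x => f.app x + f'.app x,
    F.continuous_add E.continuous_fst f.continuous_app f'.continuous_app,
    fun g _ _ h v => by simp [f.equivariant g h, f'.equivariant g h]⟩⟩

instance : Neg (E ⟶ F) :=
  ⟨fun f => ⟨fun x => - f.app x, F.continuous_neg E.continuous_fst f.continuous_app,
    fun g _ _ h v => by simp [f.equivariant g h]⟩⟩

/-- Morphisms are added fiberwise. -/
instance : AddCommGroup (E ⟶ F) where
  add_assoc f f' f'' := Hom.ext (funext fun x => add_assoc (f.app x) (f'.app x) (f''.app x))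
  zero_add f := Hom.ext (funext fun x => zero_add (f.app x))
  add_zero f := Hom.ext (funext fun x => add_zero (f.app x))
  add_comm f f' := Hom.ext (funext fun x => add_comm (f.app x) (f'.app x))
  neg_add_cancel f := Hom.ext (funext fun x => neg_add_cancel (f.app x))
  nsmul := nsmulRec
  zsmul := zsmulRec

instance : Preadditive (GModuleBundle 𝒜) where
  add_comp _ _ _ f f' g := Hom.ext (funext fun x =>
    LinearMap.comp_add (f.app x) (f'.app x) (g.app x))
  comp_add _ _ _ f g g' := Hom.ext (funext fun x =>
    LinearMap.add_comp (f.app x) (g'.app x) (g.app x))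

end GModuleBundle

/-! ### The functor `Γ` -/

variable [ContinuousConstSMul G X]

/-- The map `Γ(E) → Γ(F)` induced by a morphism of `G`-`𝒜` bundles. -/
noncomputable def sectionsMap {E F : GModuleBundle 𝒜} (f : E ⟶ F) :
    E.toModuleBundle.sections →ₗ[𝒜.crossedProduct] F.toModuleBundle.sections :=
  let φ : E.toModuleBundle.sections →+ F.toModuleBundle.sections :=
    { toFun := fun s => ⟨fun x => f.app x (s.1 x), f.continuous_app.comp s.2⟩
      map_zero' := Subtype.ext (funext fun x => map_zero (f.app x))
      map_add' := fun s t => Subtype.ext (funext fun x => map_add (f.app x) (s.1 x) (t.1 x)) }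
  { φ with
    map_smul' := fun r s => by
      change φ (r • s) = r • φ s
      induction r using SkewMonoidAlgebra.induction_on with
      | zero =>
        exact ((congrArg φ (zero_smul 𝒜.crossedProduct s)).trans (map_zero φ)).trans
          (zero_smul 𝒜.crossedProduct (φ s)).symm
      | single g b =>
        rw [E.single_smul, F.single_smul]
        refine Subtype.ext (funext fun x => ?_)
        exact (map_smul (f.app x) (b.1 x) _).trans
          (congrArg (b.1 x • ·) (f.equivariant g (smul_inv_smul g x) _))
      | add r r' h h' => rw [add_smul, add_smul, map_add, h, h'] }

@[simp]
theorem sectionsMap_apply {E F : GModuleBundle 𝒜} (f : E ⟶ F) (s : E.toModuleBundle.sections)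
    (x : X) : (sectionsMap f s).1 x = f.app x (s.1 x) := rfl

/-- The functor `Γ` from `G`-`𝒜` bundles to left `B ⋊ G`-modules. -/
noncomputable def sectionsFunctor (𝒜 : GAlgebraBundle G X A) :
    GModuleBundle 𝒜 ⥤ ModuleCat.{u} 𝒜.crossedProduct where
  obj E := ModuleCat.of _ E.toModuleBundle.sections
  map f := ModuleCat.ofHom (sectionsMap f)
  map_id _ := rfl
  map_comp _ _ := rfl

end Category

/-! ### Grothendieck groups -/

/-- The subgroup of relations `[Z] = [P] + [Q]`, for all direct sum diagrams `Z = P ⊕ Q`. -/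
def directSumRelations (C : Type*) [Category C] [Preadditive C] :
    AddSubgroup (FreeAbelianGroup C) :=
  AddSubgroup.closure {z | ∃ (P Q : C) (b : Limits.BinaryBicone P Q), Nonempty b.IsBilimit ∧
    z = FreeAbelianGroup.of b.pt - (FreeAbelianGroup.of P + FreeAbelianGroup.of Q)}

/-- The Grothendieck group of an additive category: generated by the objects, with the
relations `[P ⊕ Q] = [P] + [Q]`. (Isomorphic objects have equal classes, as an object
isomorphic to `P` is a direct sum of `P` and zero.) -/
abbrev GrothendieckGroup (C : Type*) [Category C] [Preadditive C] : Type _ :=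
  FreeAbelianGroup C ⧸ directSumRelations C

/-- The class of an object in the Grothendieck group. -/
def GrothendieckGroup.mk {C : Type*} [Category C] [Preadditive C] (P : C) :
    GrothendieckGroup C :=
  QuotientAddGroup.mk (FreeAbelianGroup.of P)

/-- Finitely generated projective left modules. -/
def fgProjective (R : Type u) [Ring R] : ObjectProperty (ModuleCat.{u} R) :=
  fun M => Module.Finite R M ∧ Module.Projective R M

/-- `K₀(R)`: the Grothendieck group of finitely generated projective left `R`-modules. -/
abbrev K₀ (R : Type u) [Ring R] : Type (u + 1) :=
  GrothendieckGroup (fgProjective R).FullSubcategory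

/-- `K_G^𝒜(X)`: the Grothendieck group of the category of `G`-`𝒜` bundles. -/
abbrev equivariantK {G X A : Type u} [Group G] [TopologicalSpace X] [MulAction G X]
    [NormedRing A] [NormedAlgebra ℝ A] (𝒜 : GAlgebraBundle G X A) : Type (u + 1) :=
  GrothendieckGroup (GModuleBundle 𝒜)

end TwistedK

open TwistedK

/-! This is the Serre–Swan theorem combined with averaging over `G`. The main tool is
`exists_dual_basis`: on a compact Hausdorff space every `𝒜`-bundle has finitely many global sections
`s i` and continuous functionals `θ i` with `∑ i, θ i v • s i = v`. Near a point they come from a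
dual basis of the projective fiber. They globalize because the functions `f` for which `f • v` can
be written in this way form an ideal of `C(X, ℝ)` that lies in no maximal ideal.

A dual basis splits `Γ(E)` off a finite free `B`-module. Since `|G|` is invertible in `ℝ`, averaging
turns this into a splitting over `B ⋊ G` (`fgProjective_sections`). The same dual basis recovers a
bundle map from its effect on sections, so `Γ` is fully faithful.

Conversely, let `M` be finitely generated projective over `B ⋊ G`. As `G` is finite, `M` has a
finite dual basis over `B`. Its coordinates identify `M` with the row vectors fixed by an idempotent
matrix over `B`, and `g` acts by `v ↦ g(v) P(g)` for matrices `P(g)` satisfying a cocycle identity.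
Evaluating at the points of `X` gives a bundle. It is locally trivial because nearby idempotents
over a Banach algebra are conjugate (`image_locally_trivial`), and its sections are `M`
(`toSection_bijective`).

The statement on `K`-groups follows because an additive equivalence preserves direct sum diagrams.
-/

namespace TwistedK

/-! ### Fibers in a local trivialization -/

section FiberEquiv

variable {X F : Type*} {E : X → Type*} [TopologicalSpace X] [TopologicalSpace F]
  [TopologicalSpace (Σ x, E x)]

/-- The bijection of a fiber with the model given by a trivialization. -/
noncomputable def fiberEquiv (e : Bundle.Trivialization F (Sigma.fst : (Σ x, E x) → X)) {y : X}
    (hy : y ∈ e.baseSet) : E y ≃ F :=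
  Equiv.ofBijective (fun v => (e ⟨y, v⟩).2) <| by
    constructor
    · intro v w h
      have h' : e ⟨y, v⟩ = e ⟨y, w⟩ :=
        Prod.ext ((e.coe_fst' (x := ⟨y, v⟩) hy).trans (e.coe_fst' (x := ⟨y, w⟩) hy).symm) h
      exact eq_of_heq (Sigma.mk.inj (e.injOn (e.mem_source.2 hy) (e.mem_source.2 hy) h')).2
    · intro p
      have h1 := e.proj_symm_apply' (b := y) (x := p) hy
      have h2 := e.apply_symm_apply' (b := y) (x := p) hy
      generalize e.toOpenPartialHomeomorph.symm (y, p) = q at h1 h2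
      obtain ⟨z, v⟩ := q
      obtain rfl : z = y := h1
      exact ⟨v, congrArg Prod.snd h2⟩

theorem fiberEquiv_apply (e : Bundle.Trivialization F (Sigma.fst : (Σ x, E x) → X)) {y : X}
    (hy : y ∈ e.baseSet) (v : E y) : fiberEquiv e hy v = (e ⟨y, v⟩).2 := rfl

@[simp]
theorem trivialization_fiberEquiv_symm
    (e : Bundle.Trivialization F (Sigma.fst : (Σ x, E x) → X)) {y : X}
    (hy : y ∈ e.baseSet) (p : F) : (e ⟨y, (fiberEquiv e hy).symm p⟩).2 = p :=
  (fiberEquiv e hy).apply_symm_apply p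

end FiberEquiv

/-! ### Scalar functions, and the algebra bundle as a module bundle -/

namespace AlgebraBundle

variable {X A Y : Type u} [TopologicalSpace X] [NormedRing A] [NormedAlgebra ℝ A]
  [TopologicalSpace Y] (𝒜 : AlgebraBundle X A)

theorem continuous_algebraMap_comp {b : Y → X} (hb : Continuous b) {r : Y → ℝ}
    (hr : Continuous r) :
    Continuous fun y => (⟨b y, algebraMap ℝ (𝒜.fiber (b y)) (r y)⟩ : Σ x, 𝒜.fiber x) := by
  refine continuous_iff_continuousAt.2 fun y => ?_
  obtain ⟨e, hx, he⟩ := 𝒜.locally_trivial (b y)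
  refine (continuousAt_iff_snd e hb.continuousAt hx).2
    (((_root_.continuous_algebraMap ℝ A).comp hr).continuousAt.congr ?_)
  filter_upwards [hb.continuousAt (e.open_baseSet.mem_nhds hx)] with z hz
  obtain ⟨φ, hφ⟩ := he (b z) hz
  simp [hφ]

/-- The algebra bundle as a bundle of modules over itself. -/
def self : ModuleBundle 𝒜 where
  fiber := 𝒜.fiber
  locally_trivial x := by
    obtain ⟨e, hx, he⟩ := 𝒜.locally_trivial x
    refine ⟨A, inferInstance, inferInstance, inferInstance, inferInstance, e, e, hx, hx, he, ?_, ?_⟩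
    · intro y hy v w
      obtain ⟨φ, hφ⟩ := he y hy
      simp [hφ]
    · intro y hy v w
      obtain ⟨φ, hφ⟩ := he y hy.1
      simp [hφ]
  continuous_smul := by
    let τ : TopologicalSpace (Σ x, 𝒜.fiber x × 𝒜.fiber x) := TopologicalSpace.induced
      (fun p => ((⟨p.1, p.2.1⟩, ⟨p.1, p.2.2⟩) : (Σ x, 𝒜.fiber x) × (Σ x, 𝒜.fiber x)))
      inferInstance
    have h : Continuous (fun p : Σ x, 𝒜.fiber x × 𝒜.fiber x =>
      ((⟨p.1, p.2.1⟩, ⟨p.1, p.2.2⟩) : (Σ x, 𝒜.fiber x) × (Σ x, 𝒜.fiber x))) :=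
      continuous_induced_dom
    have hfst : Continuous (Sigma.fst : (Σ x, 𝒜.fiber x) → X) := by
      refine continuous_iff_continuousAt.2 fun p => ?_
      obtain ⟨e, hx, -⟩ := 𝒜.locally_trivial p.1
      exact e.continuousAt_proj (e.mem_source.2 hx)
    exact 𝒜.continuous_mul (Y := Σ x, 𝒜.fiber x × 𝒜.fiber x) (b := Sigma.fst)
      (hfst.comp h.fst) h.fst h.snd
  finite_fiber x := inferInstance
  projective_fiber x := inferInstance

end AlgebraBundle

/-! ### Cutoffs and dual bases of global sections -/

namespace ModuleBundle

variable {X A Y : Type u} [TopologicalSpace X] [NormedRing A] [NormedAlgebra ℝ A]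
  [TopologicalSpace Y] {𝒜 : AlgebraBundle X A} (E : ModuleBundle 𝒜)

theorem continuousAt_smul {b : Y → X} {a : ∀ y, 𝒜.fiber (b y)} {s : ∀ y, E.fiber (b y)} {y : Y}
    (ha : ContinuousAt (fun y => (⟨b y, a y⟩ : Σ x, 𝒜.fiber x)) y)
    (hs : ContinuousAt (fun y => (⟨b y, s y⟩ : Σ x, E.fiber x)) y) :
    ContinuousAt (fun y => (⟨b y, a y • s y⟩ : Σ x, E.fiber x)) y := by
  let _ : TopologicalSpace (Σ x, 𝒜.fiber x × E.fiber x) := TopologicalSpace.induced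
    (fun p => ((⟨p.1, p.2.1⟩, ⟨p.1, p.2.2⟩) : (Σ x, 𝒜.fiber x) × (Σ x, E.fiber x)))
    inferInstance
  have h : ContinuousAt (fun y => (⟨b y, (a y, s y)⟩ : Σ x, 𝒜.fiber x × E.fiber x)) y := by
    rw [ContinuousAt, nhds_induced, Filter.tendsto_comap_iff]
    exact ha.prodMk hs
  exact (E.continuous_smul.continuousAt.comp h :)

/-- A family that is continuous on a neighborhood of the support of a real function becomes
continuous when multiplied by this function. -/
theorem continuous_cutoff {b : Y → X} (hb : Continuous b) {s : ∀ y, E.fiber (b y)}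
    {r : Y → ℝ} (hr : Continuous r)
    (hs : ∀ y ∈ tsupport r, ContinuousAt (fun y => (⟨b y, s y⟩ : Σ x, E.fiber x)) y) :
    Continuous fun y =>
      (⟨b y, algebraMap ℝ (𝒜.fiber (b y)) (r y) • s y⟩ : Σ x, E.fiber x) := by
  refine continuous_iff_continuousAt.2 fun y => ?_
  by_cases hy : y ∈ tsupport r
  · exact E.continuousAt_smul (𝒜.continuous_algebraMap_comp hb hr).continuousAt (hs y hy)
  -- Off the closed support the product vanishes on a neighborhood, however badly `s` behaves there.
  · refine (E.continuous_zero hb).continuousAt.congr ?_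
    filter_upwards [(isClosed_tsupport r).isOpen_compl.mem_nhds hy] with z hz
    rw [image_eq_zero_of_notMem_tsupport hz, map_zero, zero_smul]

theorem continuous_sum {ι : Type*} (I : Finset ι) {b : Y → X} (hb : Continuous b)
    {s : ι → ∀ y, E.fiber (b y)}
    (hs : ∀ i ∈ I, Continuous fun y => (⟨b y, s i y⟩ : Σ x, E.fiber x)) :
    Continuous fun y => (⟨b y, ∑ i ∈ I, s i y⟩ : Σ x, E.fiber x) := by
  classical
  induction I using Finset.induction_on with
  | empty => simpa using E.continuous_zero hb
  | insert i I hi ih =>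
    simp only [Finset.sum_insert hi]
    exact E.continuous_add hb (hs i (by simp)) (ih fun j hj => hs j (by simp [hj]))

/-- A continuous fiberwise linear map from a module bundle to the algebra bundle. -/
structure Functional where
  app : ∀ x, E.fiber x →ₗ[𝒜.fiber x] 𝒜.fiber x
  continuous_app : Continuous fun p : Σ x, E.fiber x => (⟨p.1, app p.1 p.2⟩ : Σ x, 𝒜.fiber x)

variable {E} in
/-- The map on sections induced by a functional. -/
def Functional.onSections (θ : E.Functional) : E.sections →ₗ[𝒜.sections] 𝒜.sections where
  toFun s := ⟨fun x => θ.app x (s.1 x), θ.continuous_app.comp s.2⟩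
  map_add' _ _ := Subtype.ext (funext fun x => map_add (θ.app x) _ _)
  map_smul' _ _ := Subtype.ext (funext fun x => map_smul (θ.app x) _ _)

/-- The ideal of functions `f` such that multiplication by `f` on the bundle factors through a
finite free bundle. -/
def dualIdeal : Ideal C(X, ℝ) where
  carrier := {f | ∃ (ι : Type) (_ : Fintype ι) (s : ι → E.sections) (θ : ι → E.Functional),
    ∀ x (v : E.fiber x), ∑ i, (θ i).app x v • (s i).1 x = algebraMap ℝ (𝒜.fiber x) (f x) • v}
  zero_mem' := ⟨Empty, inferInstance, Empty.elim, Empty.elim, fun x v => by simp⟩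
  add_mem' := by
    rintro f g ⟨ι, _, s, θ, h⟩ ⟨κ, _, t, η, k⟩
    refine ⟨ι ⊕ κ, inferInstance, Sum.elim s t, Sum.elim θ η, fun x v => ?_⟩
    simp [h, k, add_smul]
  smul_mem' := by
    rintro c f ⟨ι, _, s, θ, h⟩
    let b : 𝒜.sections := ⟨fun x => algebraMap ℝ _ (c x),
      𝒜.continuous_algebraMap_comp continuous_id c.continuous⟩
    -- The factor `c` is absorbed into the sections; this is harmless because real scalars are
    -- central in each fiber.
    refine ⟨ι, inferInstance, fun i => b • s i, θ, fun x v => ?_⟩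
    have h1 : ∀ i, (θ i).app x v • (b • s i).1 x =
        algebraMap ℝ (𝒜.fiber x) (c x) • ((θ i).app x v • (s i).1 x) := fun i => by
      rw [sections_smul_apply, smul_smul, smul_smul, (Algebra.commutes (c x) _).symm]
    simp_rw [h1]
    rw [← Finset.smul_sum, h, smul_smul, ← map_mul]
    rfl

theorem exists_tsupport_subset [CompactSpace X] [T2Space X] {x : X} {U : Set X} (hU : IsOpen U)
    (hx : x ∈ U) : ∃ f : C(X, ℝ), tsupport f ⊆ U ∧ f x = 1 := by
  obtain ⟨f, h1, h2, -⟩ := exists_tsupport_one_of_isOpen_isClosed hU isClosed_closure.isCompact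
    (isClosed_singleton (x := x)) (by simpa using hx)
  exact ⟨f, h1, h2 rfl⟩

open Classical in
/-- A local section that is constant in a trivialization. -/
noncomputable def localSection {P : Type*} [TopologicalSpace P]
    (e : Bundle.Trivialization P (Sigma.fst : (Σ x, E.fiber x) → X)) (p : P) (y : X) :
    E.fiber y :=
  if h : y ∈ e.baseSet then (fiberEquiv e h).symm p else 0

/-- The model vector may vary with the parameter: constant vectors give local sections of `E`, and
varying ones give the inverse of the trivialization in `image_locally_trivial`. -/
theorem continuousAt_localSection {P : Type*} [TopologicalSpace P]
    (e : Bundle.Trivialization P (Sigma.fst : (Σ x, E.fiber x) → X)) {b : Y → X} {c : Y → P}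
    {y : Y} (hb : ContinuousAt b y) (hc : ContinuousAt c y) (hy : b y ∈ e.baseSet) :
    ContinuousAt (fun z => (⟨b z, E.localSection e (c z) (b z)⟩ : Σ x, E.fiber x)) y := by
  refine (continuousAt_iff_snd e hb hy).2 (hc.congr ?_)
  filter_upwards [hb (e.open_baseSet.mem_nhds hy)] with z hz
  rw [localSection, dif_pos (show b z ∈ e.baseSet from hz), trivialization_fiberEquiv_symm]

section Compact

variable [CompactSpace X] [T2Space X]

/-- A local section that is constant in a trivialization is cut off by a function equal to `1` at
`x`. Identities between fiber maps can therefore be tested on global sections. -/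
theorem exists_section_eq {x : X} (v : E.fiber x) : ∃ s : E.sections, s.1 x = v := by
  obtain ⟨P, _, _, _, _, eA, e, -, hx, -, -, -⟩ := E.locally_trivial x
  obtain ⟨f, hf, hfx⟩ := exists_tsupport_subset e.open_baseSet hx
  refine ⟨⟨fun y => algebraMap ℝ (𝒜.fiber y) (f y) • E.localSection e (e ⟨x, v⟩).2 y,
    E.continuous_cutoff continuous_id f.continuous fun y hy =>
      E.continuousAt_localSection e continuousAt_id continuousAt_const (hf hy)⟩, ?_⟩
  simp only [hfx, map_one, one_smul, localSection, hx, dif_pos]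
  exact (fiberEquiv e hx).symm_apply_apply v

/-- A dual basis of the fiber at `x` is carried to the model `P`, spread over a neighborhood as
constant data in the trivializations, and cut off by `f`. -/
theorem exists_mem_dualIdeal (x : X) : ∃ f ∈ E.dualIdeal, f x ≠ 0 := by
  classical
  obtain ⟨P, _, _, _, _, eA, e, hxA, hx, heA, hadd, hsmul⟩ := E.locally_trivial x
  have := E.finite_fiber x
  have := E.projective_fiber x
  obtain ⟨f, hf, hfx⟩ := exists_tsupport_subset (eA.open_baseSet.inter e.open_baseSet) ⟨hxA, hx⟩
  obtain ⟨n, π, σ, -, -, hπσ⟩ :=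
    Module.Finite.exists_comp_eq_id_of_projective (𝒜.fiber x) (E.fiber x)
  have heA_add : ∀ y ∈ eA.baseSet, ∀ a b : 𝒜.fiber y,
      (eA ⟨y, a + b⟩).2 = (eA ⟨y, a⟩).2 + (eA ⟨y, b⟩).2 := fun y hy a b => by
    obtain ⟨φ, hφ⟩ := heA y hy
    simp [hφ]
  have heA_mul : ∀ y ∈ eA.baseSet, ∀ a b : 𝒜.fiber y,
      (eA ⟨y, a * b⟩).2 = (eA ⟨y, a⟩).2 * (eA ⟨y, b⟩).2 := fun y hy a b => by
    obtain ⟨φ, hφ⟩ := heA y hy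
    simp [hφ]
  -- Nothing is assumed about `P` itself. Its dual basis `Θ`, `p` is that of `E_x`, transported
  -- along `ε`, which is semilinear over the identification of `𝒜_x` with `A`.
  let ε : E.fiber x ≃+ P := { fiberEquiv e hx with map_add' := hadd x hx }
  have hε_smul : ∀ a v, ε (a • v) = (eA ⟨x, a⟩).2 • ε v := hsmul x ⟨hxA, hx⟩
  have hε_symm : ∀ (a : A) (p : P), ε.symm (a • p) = (fiberEquiv eA hxA).symm a • ε.symm p := by
    intro a p
    apply ε.injective
    rw [hε_smul]
    simp
  let Θ : Fin n → P →ₗ[A] A := fun i =>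
    { toFun := fun p => (eA ⟨x, σ (ε.symm p) i⟩).2
      map_add' := fun p q => by simp [heA_add x hxA]
      map_smul' := fun a p => by simp [hε_symm, heA_mul x hxA] }
  let p : Fin n → P := fun i => ε (π (Pi.single i 1))
  have hΘ : ∀ q, ∑ i, Θ i q • p i = q := by
    intro q
    have h1 : ∀ i, Θ i q • p i = ε (σ (ε.symm q) i • π (Pi.single i 1)) := fun i =>
      (hε_smul _ _).symm
    simp_rw [h1]
    rw [← map_sum]
    simp_rw [← map_smul]
    rw [← map_sum]
    have h2 : ∑ i, σ (ε.symm q) i • Pi.single i (1 : 𝒜.fiber x) = σ (ε.symm q) := by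
      ext j; simp [Finset.sum_apply, Pi.single_apply]
    rw [h2]
    have h3 := DFunLike.congr_fun hπσ (ε.symm q)
    simp only [LinearMap.comp_apply, LinearMap.id_apply] at h3
    rw [h3]; simp
  -- Linear forms are automatically continuous because `P` carries the module topology.
  have hΘc : ∀ i, Continuous (Θ i) := fun i => IsModuleTopology.continuous_of_linearMap _
  let θ : Fin n → ∀ y, E.fiber y →ₗ[𝒜.fiber y] 𝒜.fiber y := fun i y =>
    if h : y ∈ eA.baseSet ∩ e.baseSet then
      { toFun := fun v => (fiberEquiv eA h.1).symm (Θ i (e ⟨y, v⟩).2)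
        map_add' := fun v w => by
          apply (fiberEquiv eA h.1).injective
          simp [fiberEquiv_apply, heA_add y h.1, hadd y h.2]
        map_smul' := fun a v => by
          apply (fiberEquiv eA h.1).injective
          simp [fiberEquiv_apply, heA_mul y h.1, hsmul y h] }
    else 0
  have hθ : ∀ i y (h : y ∈ eA.baseSet ∩ e.baseSet) v,
      (eA ⟨y, θ i y v⟩).2 = Θ i (e ⟨y, v⟩).2 := by
    intro i y h v
    simp only [θ, dif_pos h]
    exact trivialization_fiberEquiv_symm eA h.1 _
  -- The square arises because the sections and the functionals are each multiplied by `f`.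
  refine ⟨f * f, ⟨Fin n, inferInstance,
    fun i => ⟨fun y => algebraMap ℝ (𝒜.fiber y) (f y) • E.localSection e (p i) y,
    E.continuous_cutoff continuous_id f.continuous fun y hy =>
      E.continuousAt_localSection e continuousAt_id continuousAt_const (hf hy).2⟩,
    fun i => ⟨fun y => f y • θ i y, ?_⟩, fun y v => ?_⟩, by simp [hfx]⟩
  · have := 𝒜.self.continuous_cutoff (Y := Σ x, E.fiber x) (b := Sigma.fst) E.continuous_fst
      (s := fun q => θ i q.1 q.2) (r := fun q => f q.1) (f.continuous.comp E.continuous_fst) ?_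
    · refine this.congr fun q => ?_
      simp only [LinearMap.smul_apply, Algebra.smul_def]
      rfl
    · intro q hq
      have hq' : q.1 ∈ eA.baseSet ∩ e.baseSet :=
        hf (tsupport_comp_subset_preimage f E.continuous_fst hq)
      refine (continuousAt_iff_snd eA (E.continuous_fst.continuousAt (x := q)) hq'.1).2 ?_
      have h1 : ContinuousAt (fun z : Σ x, E.fiber x => (e z).2) q :=
        (continuousAt_iff_snd e (s := fun z : Σ x, E.fiber x => z)
          (E.continuous_fst.continuousAt (x := q)) hq'.2).1 continuousAt_id
      refine ((hΘc i).continuousAt.comp h1).congr ?_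
      filter_upwards [E.continuous_fst.continuousAt
        ((eA.open_baseSet.inter e.open_baseSet).mem_nhds hq')] with z hz
      exact (hθ i z.1 hz z.2).symm
  · by_cases h : y ∈ eA.baseSet ∩ e.baseSet
    · have h1 : ∀ i, (f y • θ i y) v • algebraMap ℝ (𝒜.fiber y) (f y) • E.localSection e (p i) y =
          algebraMap ℝ (𝒜.fiber y) (f y * f y) • (θ i y v • E.localSection e (p i) y) := by
        intro i
        simp only [LinearMap.smul_apply, Algebra.smul_def, smul_smul, map_mul]
        rw [mul_assoc, mul_assoc, ← Algebra.commutes (f y) (θ i y v)]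
      simp_rw [h1]
      rw [← Finset.smul_sum]
      congr 1
      let εy : E.fiber y ≃+ P := { fiberEquiv e h.2 with map_add' := hadd y h.2 }
      apply εy.injective
      rw [map_sum]
      have h2 : ∀ i, εy (θ i y v • E.localSection e (p i) y) = Θ i (εy v) • p i := by
        intro i
        refine (hsmul y h _ _).trans ?_
        rw [hθ i y h]
        simp only [localSection, h.2, dif_pos, trivialization_fiberEquiv_symm]
        rfl
      simp_rw [h2]
      exact hΘ _
    · have h1 : f y = 0 := image_eq_zero_of_notMem_tsupport fun h' => h (hf h')
      simp [h1]

/-- Every module bundle on a compact Hausdorff space has a finite dual basis of global sections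
and functionals. -/
theorem exists_dual_basis : ∃ (ι : Type) (_ : Fintype ι) (s : ι → E.sections)
    (θ : ι → E.Functional), ∀ x (v : E.fiber x), ∑ i, (θ i).app x v • (s i).1 x = v := by
  have htop : E.dualIdeal = ⊤ := by
    by_contra hne
    obtain ⟨M, hM, hle⟩ := Ideal.exists_le_maximal _ hne
    -- A maximal ideal of `C(X, ℝ)` consists of the functions vanishing at some point. This argument
    -- replaces a partition of unity.
    obtain ⟨x, rfl⟩ := (ContinuousMap.ideal_isMaximal_iff M).1 hM
    obtain ⟨f, hf, hfx⟩ := E.exists_mem_dualIdeal x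
    exact hfx (ContinuousMap.mem_idealOfSet.1 (hle hf) (by simp))
  have h : (1 : C(X, ℝ)) ∈ E.dualIdeal := htop ▸ Submodule.mem_top
  obtain ⟨ι, hι, s, θ, h⟩ := h
  exact ⟨ι, hι, s, θ, fun x v => by simpa using h x v⟩

end Compact

end ModuleBundle

/-! ### Projectivity of the module of sections, by averaging -/

section Sections

variable {G X A : Type u} [Group G] [TopologicalSpace X] [MulAction G X]
  [NormedRing A] [NormedAlgebra ℝ A] [ContinuousConstSMul G X] {𝒜 : GAlgebraBundle G X A}

namespace GModuleBundle

variable (E : GModuleBundle 𝒜)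

open Classical in
/-- The equivariant extension of a functional on a bundle to a linear form over the twisted group
ring on its sections. -/
noncomputable def equivariantFunctional [Fintype G] (θ : E.toModuleBundle.Functional) :
    E.toModuleBundle.sections →ₗ[𝒜.crossedProduct] 𝒜.crossedProduct :=
  let Θ : E.toModuleBundle.sections →+ 𝒜.crossedProduct :=
    { toFun := fun s => ∑ g : G, SkewMonoidAlgebra.single g (g • θ.onSections (g⁻¹ • s))
      map_zero' := by simp
      map_add' := fun s t => by
        simp only [smul_add, map_add, SkewMonoidAlgebra.single_add, Finset.sum_add_distrib] }
  { Θ with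
    map_smul' := fun r s => by
      change Θ (r • s) = r * Θ s
      induction r using SkewMonoidAlgebra.induction_on with
      | zero =>
        rw [zero_mul]
        exact (congrArg Θ (zero_smul 𝒜.crossedProduct s)).trans (map_zero Θ)
      | single h b =>
        rw [E.single_smul]
        change ∑ g : G, SkewMonoidAlgebra.single g (g • θ.onSections (g⁻¹ • b • h • s)) =
          SkewMonoidAlgebra.single h b *
            ∑ g : G, SkewMonoidAlgebra.single g (g • θ.onSections (g⁻¹ • s))
        -- With `g` replaced by `h * g` on the left the sums agree termwise: `(h * g)⁻¹ * h = g⁻¹`,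
        -- and the factor `(h * g)⁻¹ • b` pulled out of `θ` is returned to `b` by `h * g`.
        rw [Finset.mul_sum, ← Equiv.sum_comp (Equiv.mulLeft h)]
        refine Finset.sum_congr rfl fun g _ => ?_
        rw [SkewMonoidAlgebra.single_mul_single, Equiv.coe_mulLeft, E.smul_smul_sections,
          map_smul, smul_eq_mul, smul_mul', smul_inv_smul, smul_smul _ h s, mul_inv_rev,
          inv_mul_cancel_right, mul_smul h g]
      | add r r' h h' => rw [add_smul, add_mul, map_add, h, h'] }

theorem equivariantFunctional_apply [Fintype G] (θ : E.toModuleBundle.Functional)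
    (s : E.toModuleBundle.sections) : E.equivariantFunctional θ s =
      ∑ g : G, SkewMonoidAlgebra.single g (g • θ.onSections (g⁻¹ • s)) := rfl

/-- With `c = 1 / |G|`, the forms `equivariantFunctional (θ a)` and the sections `c • s a` are a
dual basis over `B ⋊ G`: the summand at `g` contributes `g (c (g⁻¹ t)) = c t`, and there are `|G|`
of them. -/
theorem fgProjective_sections [Finite G] [CompactSpace X] [T2Space X] :
    fgProjective 𝒜.crossedProduct ((sectionsFunctor 𝒜).obj E) := by
  classical
  have := Fintype.ofFinite G
  obtain ⟨ι, _, s, θ, h⟩ := E.toModuleBundle.exists_dual_basis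
  let c : 𝒜.toAlgebraBundle.sections := ⟨fun x => algebraMap ℝ _ (Fintype.card G : ℝ)⁻¹,
    𝒜.continuous_algebraMap continuous_id _⟩
  -- `G` acts by `ℝ`-algebra isomorphisms, so real constants are invariant.
  have hc : ∀ g : G, g • c = c := fun g =>
    Subtype.ext (funext fun x => (𝒜.act g (smul_inv_smul g x)).commutes _)
  let i : E.toModuleBundle.sections →ₗ[𝒜.crossedProduct] (ι → 𝒜.crossedProduct) :=
    LinearMap.pi fun a => E.equivariantFunctional (θ a)
  let π : (ι → 𝒜.crossedProduct) →ₗ[𝒜.crossedProduct] E.toModuleBundle.sections :=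
    Fintype.linearCombination 𝒜.crossedProduct fun a => c • s a
  have hπ : π ∘ₗ i = LinearMap.id := by
    refine LinearMap.ext fun t => ?_
    have h1 : ∀ (t : E.toModuleBundle.sections), ∑ a, (θ a).onSections t • c • s a = c • t := by
      intro t
      refine Subtype.ext (funext fun x => ?_)
      rw [AddSubgroup.val_finsetSum, Finset.sum_apply]
      have : ∀ a, ((θ a).onSections t • c • s a).1 x = c.1 x • ((θ a).app x (t.1 x) • (s a).1 x) := by
        intro a
        rw [ModuleBundle.sections_smul_apply, ModuleBundle.sections_smul_apply, smul_smul,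
          smul_smul]
        congr 1
        exact (Algebra.commutes _ _).symm
      simp_rw [this]
      rw [← Finset.smul_sum, h, ModuleBundle.sections_smul_apply]
    have h2 : π (i t) = ∑ g : G, c • t := by
      calc π (i t) = ∑ a, ∑ g : G, (SkewMonoidAlgebra.single g
            (g • (θ a).onSections (g⁻¹ • t)) : 𝒜.crossedProduct) • (c • s a) := by
            simp only [π, i, Fintype.linearCombination_apply, LinearMap.pi_apply,
              equivariantFunctional_apply, Finset.sum_smul]
        _ = ∑ g : G, g • ∑ a, (θ a).onSections (g⁻¹ • t) • c • s a := by
            rw [Finset.sum_comm]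
            refine Finset.sum_congr rfl fun g _ => ?_
            rw [Finset.smul_sum]
            refine Finset.sum_congr rfl fun a _ => ?_
            rw [E.single_smul, ← E.smul_smul_sections]
        _ = _ := by
            refine Finset.sum_congr rfl fun g _ => ?_
            rw [h1, E.smul_smul_sections, hc, smul_inv_smul]
    rw [LinearMap.comp_apply, LinearMap.id_apply, h2, ← Finset.sum_smul]
    refine Subtype.ext (funext fun x => ?_)
    have h3 : (∑ _g : G, c).1 x = 1 := by
      rw [AddSubmonoidClass.coe_finsetSum, Finset.sum_apply, Finset.sum_const, Finset.card_univ]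
      change Fintype.card G • algebraMap ℝ (𝒜.fiber x) (Fintype.card G : ℝ)⁻¹ = 1
      rw [nsmul_eq_mul, ← map_natCast (algebraMap ℝ (𝒜.fiber x)), ← map_mul,
        mul_inv_cancel₀ (by simp), map_one]
    rw [ModuleBundle.sections_smul_apply, h3, one_smul]
  constructor
  · exact Module.Finite.of_surjective π fun t => ⟨i t, DFunLike.congr_fun hπ t⟩
  · exact Module.Projective.of_split i π hπ

end GModuleBundle

/-! ### Full faithfulness -/

section FullyFaithful

variable [CompactSpace X] [T2Space X]

instance sectionsFunctor_faithful : (sectionsFunctor 𝒜).Faithful where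
  map_injective {E F f f'} h := by
    refine GModuleBundle.Hom.ext (funext fun x => LinearMap.ext fun v => ?_)
    obtain ⟨s, rfl⟩ := E.toModuleBundle.exists_section_eq v
    have h1 : sectionsMap f s = sectionsMap f' s :=
      DFunLike.congr_fun (congrArg ModuleCat.Hom.hom h) s
    exact congrFun (congrArg Subtype.val h1) x

/-- The map `v ↦ ∑ i, θ i v • φ (s i)` is visibly continuous and fiberwise linear. It induces `φ`
since `t = ∑ i, θ i t • s i` for every section `t`; equivariance is then read off from values of
sections. -/
theorem exists_sectionsMap_eq {E F : GModuleBundle 𝒜}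
    (φ : E.toModuleBundle.sections →ₗ[𝒜.crossedProduct] F.toModuleBundle.sections) :
    ∃ f : E ⟶ F, sectionsMap f = φ := by
  obtain ⟨ι, _, s, θ, h⟩ := E.toModuleBundle.exists_dual_basis
  have hB : ∀ (b : 𝒜.toAlgebraBundle.sections) (t : E.toModuleBundle.sections),
      φ (b • t) = b • φ t := by
    intro b t
    have := φ.map_smul (SkewMonoidAlgebra.single 1 b) t
    rwa [E.single_smul, F.single_smul, one_smul, one_smul] at this
  have hG : ∀ (g : G) (t : E.toModuleBundle.sections), φ (g • t) = g • φ t := by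
    intro g t
    have := φ.map_smul (SkewMonoidAlgebra.single g 1) t
    rwa [E.single_smul, F.single_smul, one_smul, one_smul] at this
  let f : ∀ x, E.fiber x →ₗ[𝒜.fiber x] F.fiber x := fun x =>
    ∑ i, ((θ i).app x).smulRight ((φ (s i)).1 x)
  have hf : ∀ x v, f x v = ∑ i, (θ i).app x v • (φ (s i)).1 x := fun x v => by simp [f]
  have hfs : ∀ (t : E.toModuleBundle.sections) x, f x (t.1 x) = (φ t).1 x := by
    intro t x
    have ht : t = ∑ i, (θ i).onSections t • s i := by
      refine Subtype.ext (funext fun x => ?_)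
      rw [AddSubgroup.val_finsetSum, Finset.sum_apply]
      exact (h x (t.1 x)).symm
    conv_rhs => rw [ht, map_sum, AddSubgroup.val_finsetSum, Finset.sum_apply]
    rw [hf]
    refine Finset.sum_congr rfl fun i _ => ?_
    rw [hB]
    rfl
  refine ⟨⟨f, ?_, ?_⟩, ?_⟩
  · simp_rw [hf]
    refine F.continuous_sum Finset.univ E.continuous_fst fun i _ => ?_
    exact F.continuous_smul' (θ i).continuous_app ((φ (s i)).2.comp E.continuous_fst)
  · intro g x y hxy v
    obtain ⟨t, rfl⟩ := E.toModuleBundle.exists_section_eq v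
    subst hxy
    have key : ∀ (M : GModuleBundle 𝒜) (t : M.toModuleBundle.sections),
        (g • t).1 (g • x) = M.act g rfl (t.1 x) := by
      intro M t
      have : ∀ z (hz : g • z = g • x), M.act g hz (t.1 z) = M.act g rfl (t.1 x) := by
        intro z hz
        obtain rfl := smul_left_cancel g hz
        rfl
      exact this _ _
    rw [← key E t, hfs, hfs, hG, key F]
  · exact LinearMap.ext fun t => Subtype.ext (funext fun x => hfs t x)

instance sectionsFunctor_full : (sectionsFunctor 𝒜).Full where
  map_surjective {E F} φ := by
    obtain ⟨f, hf⟩ := exists_sectionsMap_eq φ.hom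
    exact ⟨f, ModuleCat.hom_ext hf⟩

end FullyFaithful

end Sections

/-! ### Invertible matrices and row spaces of idempotents -/

open scoped Matrix

section Matrix

variable {A ι : Type*} [NormedRing A] [CompleteSpace A] [Fintype ι] [DecidableEq ι]

/-- The operator norm makes matrices over `A` a complete normed ring with the entrywise topology.
Completeness of `A` enters the proof only here and in the continuity of inversion. -/
theorem isOpen_isUnit_matrix : IsOpen {M : Matrix ι ι A | IsUnit M} := by
  let _ := Matrix.linftyOpNormedRing (n := ι) (α := A)
  have : @CompleteSpace (Matrix ι ι A) PseudoMetricSpace.toUniformSpace :=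
    inferInstanceAs (CompleteSpace (ι → ι → A))
  exact Units.isOpen

theorem continuousAt_inverse_matrix {M : Matrix ι ι A} (hM : IsUnit M) :
    ContinuousAt Ring.inverse M := by
  let _ := Matrix.linftyOpNormedRing (n := ι) (α := A)
  have : @CompleteSpace (Matrix ι ι A) PseudoMetricSpace.toUniformSpace :=
    inferInstanceAs (CompleteSpace (ι → ι → A))
  obtain ⟨u, rfl⟩ := hM
  exact NormedRing.inverse_continuousAt u

end Matrix

section RowSpace

variable {R ι : Type*} [Ring R] [Fintype ι]

/-- The row vectors fixed by right multiplication with a matrix. For an idempotent matrix this is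
its row space. -/
def fixedRows (M : Matrix ι ι R) : Submodule R (ι → R) where
  carrier := {v | v ᵥ* M = v}
  add_mem' {v w} hv hw := by
    change (v + w) ᵥ* M = v + w
    rw [Matrix.add_vecMul, hv, hw]
  zero_mem' := Matrix.zero_vecMul M
  smul_mem' a v hv := by
    change (a • v) ᵥ* M = a • v
    rw [Matrix.smul_vecMul, hv]

theorem mem_fixedRows {M : Matrix ι ι R} {v : ι → R} : v ∈ fixedRows M ↔ v ᵥ* M = v := Iff.rfl

/-- The projection onto the row space of an idempotent matrix. -/
def rowProj {M : Matrix ι ι R} (hM : M * M = M) : (ι → R) →ₗ[R] fixedRows M where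
  toFun v := ⟨v ᵥ* M, by rw [mem_fixedRows, Matrix.vecMul_vecMul, hM]⟩
  map_add' v w := Subtype.ext (Matrix.add_vecMul M v w)
  map_smul' a v := Subtype.ext (Matrix.smul_vecMul a v M)

theorem rowProj_apply {M : Matrix ι ι R} (hM : M * M = M) (v : ι → R) :
    (rowProj hM v).1 = v ᵥ* M := rfl

theorem rowProj_coe {M : Matrix ι ι R} (hM : M * M = M) (v : fixedRows M) :
    rowProj hM v.1 = v := Subtype.ext v.2

/-- It suffices that the identity from the subspace topology to the module topology is continuous.
It factors as the inclusion into `ι → R` followed by `rowProj`, which is continuous as a linear map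
out of a finite free module. -/
theorem isModuleTopology_fixedRows [TopologicalSpace R] [IsTopologicalRing R]
    {M : Matrix ι ι R} (hM : M * M = M) : IsModuleTopology R (fixedRows M) := by
  refine IsModuleTopology.of_continuous_id ?_
  have h : (id : fixedRows M → fixedRows M) = rowProj hM ∘ Subtype.val :=
    funext fun v => (rowProj_coe hM v).symm
  have h1 : @Continuous _ _ _ (moduleTopology R (fixedRows M)) (rowProj hM) := by
    let τ : TopologicalSpace (fixedRows M) := moduleTopology R (fixedRows M)
    have : IsModuleTopology R (fixedRows M) := ⟨rfl⟩
    have : ContinuousAdd (fixedRows M) := ModuleTopology.continuousAdd R _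
    have : ContinuousSMul R (fixedRows M) := ModuleTopology.continuousSMul R _
    exact IsModuleTopology.continuous_of_linearMap (rowProj hM)
  rw [h]
  exact @Continuous.comp _ _ _ _ _ (moduleTopology R (fixedRows M)) _ _ h1 continuous_subtype_val

end RowSpace

/-! ### The bundle defined by an idempotent matrix of sections -/

namespace AlgebraBundle

variable {X A Y : Type u} [TopologicalSpace X] [NormedRing A] [NormedAlgebra ℝ A]
  [TopologicalSpace Y] (𝒜 : AlgebraBundle X A)

/-- Evaluation of sections at a point. -/
def evalHom (x : X) : 𝒜.sections →+* 𝒜.fiber x :=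
  (Pi.evalRingHom 𝒜.fiber x).comp 𝒜.sections.subtype

@[simp]
theorem evalHom_apply (x : X) (b : 𝒜.sections) : 𝒜.evalHom x b = b.1 x := rfl

variable {ι : Type u} [Fintype ι] (p : Matrix ι ι 𝒜.sections)

/-- The fiber at `x` of the image of a matrix of sections. -/
abbrev imageFiber (x : X) : Type u := fixedRows (p.map (𝒜.evalHom x))

/-- The topology on the total space of the image of a matrix. -/
instance imageTopology : TopologicalSpace (Σ x, 𝒜.imageFiber p x) :=
  TopologicalSpace.induced
    -- The factor `X` is needed when `ι` is empty, since the coordinates then do not record the base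
    -- point.
    (fun q => ((q.1, fun a => ⟨q.1, q.2.1 a⟩) : X × (ι → Σ x, 𝒜.fiber x))) inferInstance

variable {p}

theorem continuousAt_image_iff {f : Y → Σ x, 𝒜.imageFiber p x} {y : Y} :
    ContinuousAt f y ↔ ContinuousAt (fun z => (f z).1) y ∧
      ∀ a, ContinuousAt (fun z => (⟨(f z).1, (f z).2.1 a⟩ : Σ x, 𝒜.fiber x)) y := by
  rw [ContinuousAt, nhds_induced, Filter.tendsto_comap_iff, nhds_prod_eq, Filter.tendsto_prod_iff',
    tendsto_pi_nhds]
  rfl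

theorem continuous_image_iff {f : Y → Σ x, 𝒜.imageFiber p x} :
    Continuous f ↔ Continuous (fun z => (f z).1) ∧
      ∀ a, Continuous (fun z => (⟨(f z).1, (f z).2.1 a⟩ : Σ x, 𝒜.fiber x)) := by
  simp only [continuous_iff_continuousAt, continuousAt_image_iff, forall_and]
  exact and_congr_right fun _ => forall_comm

theorem continuous_image_fst : Continuous (Sigma.fst : (Σ x, 𝒜.imageFiber p x) → X) :=
  (𝒜.continuous_image_iff.1 continuous_id).1

theorem continuous_image_apply (a : ι) :
    Continuous fun q : Σ x, 𝒜.imageFiber p x => (⟨q.1, q.2.1 a⟩ : Σ x, 𝒜.fiber x) :=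
  (𝒜.continuous_image_iff.1 continuous_id).2 a

theorem map_eval_mul_self (hp : p * p = p) (x : X) :
    p.map (𝒜.evalHom x) * p.map (𝒜.evalHom x) = p.map (𝒜.evalHom x) := by
  rw [← Matrix.map_mul, hp]

variable [CompleteSpace A]

/-- In a trivialization of `𝒜`, the matrix `p` becomes a continuous family of idempotents `N y`.
With `Q = N x`, the matrix `U y = Q N y + (1 - Q)(1 - N y)` satisfies `U N = Q U` and `U x = 1`. It
is therefore invertible near `x`, and right multiplication by its inverse carries the row space of
`N y` onto that of `Q`. -/
theorem image_locally_trivial (hp : p * p = p) (x : X) :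
    ∃ (P : Type u) (_ : AddCommGroup P) (_ : Module A P) (_ : TopologicalSpace P)
      (_ : IsModuleTopology A P)
      (eA : Bundle.Trivialization A (Sigma.fst : (Σ x, 𝒜.fiber x) → X))
      (e : Bundle.Trivialization P (Sigma.fst : (Σ x, 𝒜.imageFiber p x) → X)),
      x ∈ eA.baseSet ∧ x ∈ e.baseSet ∧ IsAlgebraTrivialization eA ∧
      (∀ y ∈ e.baseSet, ∀ v w : 𝒜.imageFiber p y,
        (e ⟨y, v + w⟩).2 = (e ⟨y, v⟩).2 + (e ⟨y, w⟩).2) ∧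
      (∀ y ∈ eA.baseSet ∩ e.baseSet, ∀ (a : 𝒜.fiber y) (v : 𝒜.imageFiber p y),
        (e ⟨y, a • v⟩).2 = (eA ⟨y, a⟩).2 • (e ⟨y, v⟩).2) := by
  classical
  obtain ⟨eA, hx, heA⟩ := 𝒜.locally_trivial x
  let H : ∀ y, (ι → 𝒜.fiber y) → ι → A := fun y v a => (eA ⟨y, v a⟩).2
  let N : X → Matrix ι ι A := fun y a b => (eA ⟨y, (p a b).1 y⟩).2
  have hHN : ∀ y ∈ eA.baseSet, ∀ v, H y (v ᵥ* p.map (𝒜.evalHom y)) = H y v ᵥ* N y := by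
    intro y hy v
    obtain ⟨φ, hφ⟩ := heA y hy
    funext b
    simp [H, N, hφ, Matrix.vecMul, dotProduct]
  have hN : ∀ y ∈ eA.baseSet, N y * N y = N y := by
    intro y hy
    obtain ⟨φ, hφ⟩ := heA y hy
    have h1 : N y = (p.map (𝒜.evalHom y)).map φ := by
      ext a b
      simp [N, hφ]
    rw [h1, ← Matrix.map_mul, 𝒜.map_eval_mul_self hp]
  have hNc : ContinuousOn N eA.baseSet := by
    intro y hy
    refine ContinuousAt.continuousWithinAt ?_
    refine continuousAt_pi.2 fun a => continuousAt_pi.2 fun b => ?_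
    exact (continuousAt_iff_snd eA (s := fun y => ⟨y, (p a b).1 y⟩) continuousAt_id hy).1
      (p a b).2.continuousAt
  set Q := N x with hQdef
  have hQ : Q * Q = Q := hN x hx
  let U : X → Matrix ι ι A := fun y => Q * N y + (1 - Q) * (1 - N y)
  have hUc : ContinuousOn U eA.baseSet :=
    (continuousOn_const.mul hNc).add (continuousOn_const.mul (continuousOn_const.sub hNc))
  have hUN : ∀ y ∈ eA.baseSet, U y * N y = Q * U y := by
    intro y hy
    have h1 := hN y hy
    simp only [U, add_mul, mul_add, mul_sub, sub_mul, mul_one, one_mul, mul_assoc, h1]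
    simp only [← mul_assoc, hQ]
    abel
  let W : Set X := eA.baseSet ∩ U ⁻¹' {M | IsUnit M}
  have hW : IsOpen W := hUc.isOpen_inter_preimage eA.open_baseSet isOpen_isUnit_matrix
  have hxW : x ∈ W := by
    refine ⟨hx, ?_⟩
    have : U x = 1 := by
      simp only [U, ← hQdef, mul_sub, sub_mul, mul_one, one_mul, hQ]
      abel
    simp [this]
  have hUi : ∀ y ∈ W, ContinuousAt (fun z => Ring.inverse (U z)) y := fun y hy =>
    ContinuousAt.comp (f := U) (continuousAt_inverse_matrix hy.2)
      (hUc.continuousAt (eA.open_baseSet.mem_nhds hy.1))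
  have hinv : ∀ y ∈ W, N y * Ring.inverse (U y) = Ring.inverse (U y) * Q := by
    intro y hy
    have h1 := Ring.inverse_mul_cancel _ hy.2
    have h2 := Ring.mul_inverse_cancel _ hy.2
    calc N y * Ring.inverse (U y)
        = Ring.inverse (U y) * U y * N y * Ring.inverse (U y) := by rw [h1, one_mul]
      _ = Ring.inverse (U y) * Q * (U y * Ring.inverse (U y)) := by
        rw [mul_assoc (Ring.inverse (U y)), hUN y hy.1]; simp only [mul_assoc]
      _ = _ := by rw [h2, mul_one]
  have hvc : Continuous fun z : (ι → A) × Matrix ι ι A => z.1 ᵥ* z.2 :=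
    continuous_fst.matrix_vecMul continuous_snd
  -- In `F` and `K` the projections `rowProj` only make the maps defined everywhere; over `W` the
  -- vectors are already fixed, so projecting changes nothing.
  let F : (Σ y, 𝒜.imageFiber p y) → X × fixedRows Q := fun q =>
    (q.1, rowProj hQ (H q.1 q.2.1 ᵥ* Ring.inverse (U q.1)))
  let S : ∀ y, fixedRows Q → ι → 𝒜.fiber y := fun y w a =>
    𝒜.self.localSection eA ((w.1 ᵥ* U y) a) y
  let K : X × fixedRows Q → Σ y, 𝒜.imageFiber p y := fun z =>
    ⟨z.1, rowProj (𝒜.map_eval_mul_self hp z.1) (S z.1 z.2)⟩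
  have hF : ∀ y ∈ W, ∀ v : 𝒜.imageFiber p y,
      (F ⟨y, v⟩).2.1 = H y v.1 ᵥ* Ring.inverse (U y) := by
    intro y hy v
    change (H y v.1 ᵥ* Ring.inverse (U y)) ᵥ* Q = _
    rw [Matrix.vecMul_vecMul, ← hinv y hy, ← Matrix.vecMul_vecMul, ← hHN y hy.1, v.2]
  have hHS : ∀ y ∈ W, ∀ w, H y (S y w) = w.1 ᵥ* U y := by
    intro y hy w
    funext a
    simp only [H, S, ModuleBundle.localSection, dif_pos hy.1]
    exact trivialization_fiberEquiv_symm eA hy.1 _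
  have hHinj : ∀ y ∈ W, Function.Injective (H y) := by
    intro y hy v w h
    funext a
    exact (fiberEquiv eA hy.1).injective (congrFun h a)
  have hS : ∀ y ∈ W, ∀ w, S y w ᵥ* p.map (𝒜.evalHom y) = S y w := by
    intro y hy w
    apply hHinj y hy
    rw [hHN y hy.1, hHS y hy, Matrix.vecMul_vecMul, hUN y hy.1, ← Matrix.vecMul_vecMul, w.2]
  let e : Bundle.Trivialization (fixedRows Q) (Sigma.fst : (Σ y, 𝒜.imageFiber p y) → X) :=
    { toFun := F
      invFun := K
      source := Sigma.fst ⁻¹' W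
      target := W ×ˢ Set.univ
      map_source' := fun q hq => ⟨hq, trivial⟩
      map_target' := fun z hz => hz.1
      left_inv' := by
        rintro ⟨y, v⟩ (hy : y ∈ W)
        refine congrArg (Sigma.mk y) (Subtype.ext ?_)
        change S y (F ⟨y, v⟩).2 ᵥ* _ = _
        rw [hS y hy]
        apply hHinj y hy
        rw [hHS y hy, hF y hy, Matrix.vecMul_vecMul, Ring.inverse_mul_cancel _ hy.2,
          Matrix.vecMul_one]
      right_inv' := by
        rintro ⟨y, w⟩ ⟨hy : y ∈ W, -⟩
        refine Prod.ext rfl (Subtype.ext ?_)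
        refine (hF y hy _).trans ?_
        rw [rowProj_apply, hS y hy, hHS y hy, Matrix.vecMul_vecMul,
          Ring.mul_inverse_cancel _ hy.2, Matrix.vecMul_one]
      open_source := hW.preimage 𝒜.continuous_image_fst
      open_target := hW.prod isOpen_univ
      continuousOn_toFun := by
        intro q (hq : q.1 ∈ W)
        refine ContinuousAt.continuousWithinAt ?_
        have hH : ContinuousAt (fun q : Σ y, 𝒜.imageFiber p y => H q.1 q.2.1) q :=
          continuousAt_pi.2 fun a => (continuousAt_iff_snd eA
            𝒜.continuous_image_fst.continuousAt hq.1).1 (𝒜.continuous_image_apply a).continuousAt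
        have hi : ContinuousAt (fun q : Σ y, 𝒜.imageFiber p y => Ring.inverse (U q.1)) q :=
          ContinuousAt.comp (f := Sigma.fst) (hUi q.1 hq) 𝒜.continuous_image_fst.continuousAt
        have := isModuleTopology_fixedRows hQ
        have hr : Continuous (rowProj hQ) := IsModuleTopology.continuous_of_linearMap _
        exact 𝒜.continuous_image_fst.continuousAt.prodMk
          (hr.continuousAt.comp (hvc.continuousAt.comp (hH.prodMk hi)))
      continuousOn_invFun := by
        rintro ⟨y, w⟩ ⟨hy : y ∈ W, -⟩
        refine ContinuousAt.continuousWithinAt ?_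
        refine 𝒜.continuousAt_image_iff.2 ⟨continuousAt_fst, fun a => ?_⟩
        have hU1 : ContinuousAt (fun z : X × fixedRows Q => U z.1) (y, w) :=
          ContinuousAt.comp (f := Prod.fst) (hUc.continuousAt (eA.open_baseSet.mem_nhds hy.1))
            continuousAt_fst
        have hc : ContinuousAt (fun z : X × fixedRows Q => (z.2.1 ᵥ* U z.1) a) (y, w) :=
          (continuous_apply a).continuousAt.comp (hvc.continuousAt.comp
            ((continuous_subtype_val.continuousAt.comp continuousAt_snd).prodMk hU1))
        refine (𝒜.self.continuousAt_localSection eA (b := Prod.fst) continuousAt_fst hc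
          hy.1).congr ?_
        filter_upwards [(continuousAt_fst : ContinuousAt Prod.fst (y, w)) (hW.mem_nhds hy)] with z hz
        refine congrArg (Sigma.mk z.1) ?_
        exact (congrFun (hS z.1 hz z.2) a).symm
      baseSet := W
      open_baseSet := hW
      source_eq := rfl
      target_eq := rfl
      proj_toFun := fun q _ => rfl }
  refine ⟨fixedRows Q, inferInstance, inferInstance, inferInstance, isModuleTopology_fixedRows hQ,
    eA, e, hx, hxW, heA, ?_, ?_⟩
  · intro y hy v w
    obtain ⟨φ, hφ⟩ := heA y hy.1
    refine Subtype.ext ((hF y hy _).trans ?_)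
    refine Eq.trans ?_ (congrArg₂ (· + ·) (hF y hy v) (hF y hy w)).symm
    rw [← Matrix.add_vecMul]
    congr 1
    funext a
    simp [H, hφ]
  · intro y hy c v
    obtain ⟨φ, hφ⟩ := heA y hy.1
    refine Subtype.ext ((hF y hy.2 _).trans ?_)
    refine Eq.trans ?_ (congrArg ((eA ⟨y, c⟩).2 • ·) (hF y hy.2 v)).symm
    rw [← Matrix.smul_vecMul]
    congr 1
    funext a
    simp [H, hφ]

/-- The module bundle that is the image of an idempotent matrix of sections. -/
def imageBundle (hp : p * p = p) : ModuleBundle 𝒜 where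
  fiber := 𝒜.imageFiber p
  locally_trivial := 𝒜.image_locally_trivial hp
  continuous_smul := by
    let τ : TopologicalSpace (Σ x, 𝒜.fiber x × 𝒜.imageFiber p x) := TopologicalSpace.induced
      (fun q => ((⟨q.1, q.2.1⟩, ⟨q.1, q.2.2⟩) : (Σ x, 𝒜.fiber x) × (Σ x, 𝒜.imageFiber p x)))
      inferInstance
    have h : Continuous (fun q : Σ x, 𝒜.fiber x × 𝒜.imageFiber p x =>
      ((⟨q.1, q.2.1⟩, ⟨q.1, q.2.2⟩) : (Σ x, 𝒜.fiber x) × (Σ x, 𝒜.imageFiber p x))) :=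
      continuous_induced_dom
    have h1 : Continuous (Sigma.fst : (Σ x, 𝒜.fiber x × 𝒜.imageFiber p x) → X) :=
      𝒜.continuous_image_fst.comp h.snd
    exact 𝒜.continuous_image_iff.2 ⟨h1, fun a => 𝒜.continuous_mul
      (Y := Σ x, 𝒜.fiber x × 𝒜.imageFiber p x) h1 h.fst
      ((𝒜.continuous_image_apply a).comp h.snd)⟩
  finite_fiber x := Module.Finite.of_surjective (rowProj (𝒜.map_eval_mul_self hp x))
    fun v => ⟨v.1, rowProj_coe (𝒜.map_eval_mul_self hp x) v⟩
  projective_fiber x := Module.Projective.of_split (Submodule.subtype _)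
    (rowProj (𝒜.map_eval_mul_self hp x))
    (LinearMap.ext fun v => rowProj_coe (𝒜.map_eval_mul_self hp x) v)

end AlgebraBundle

/-! ### Essential surjectivity: from modules to bundles -/

section EssSurj

variable {G X A : Type u} [Group G] [TopologicalSpace X] [MulAction G X]
  [NormedRing A] [NormedAlgebra ℝ A] [ContinuousConstSMul G X] {𝒜 : GAlgebraBundle G X A}

/-- The action on sections is defined through `g⁻¹ • y`; an arbitrary preimage `x` of `y` avoids
transport between fibers. -/
theorem GAlgebraBundle.smul_section_apply (g : G) (b : 𝒜.toAlgebraBundle.sections) {x y : X}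
    (h : g • x = y) : (g • b).1 y = 𝒜.act g h (b.1 x) := by
  have : ∀ z (hz : g • z = y), 𝒜.act g hz (b.1 z) = 𝒜.act g h (b.1 x) := by
    intro z hz
    obtain rfl : z = x := smul_left_cancel g (hz.trans h.symm)
    rfl
  exact this _ _

namespace GAlgebraBundle

theorem single_one_mul_single (g : G) (b : 𝒜.toAlgebraBundle.sections) :
    (SkewMonoidAlgebra.single 1 b : 𝒜.crossedProduct) * SkewMonoidAlgebra.single g 1 =
      SkewMonoidAlgebra.single g b := by
  rw [SkewMonoidAlgebra.single_mul_single, one_mul, one_smul, mul_one]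

theorem single_mul_single_one (g : G) (b : 𝒜.toAlgebraBundle.sections) :
    (SkewMonoidAlgebra.single g 1 : 𝒜.crossedProduct) * SkewMonoidAlgebra.single 1 b =
      SkewMonoidAlgebra.single g (g • b) := by
  rw [SkewMonoidAlgebra.single_mul_single, one_mul, mul_one]

theorem single_mul_single_group (g h : G) :
    (SkewMonoidAlgebra.single g 1 : 𝒜.crossedProduct) * SkewMonoidAlgebra.single h 1 =
      SkewMonoidAlgebra.single (g * h) 1 := by
  rw [SkewMonoidAlgebra.single_mul_single, smul_one, one_mul]

end GAlgebraBundle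

/-- A finite dual basis of a module over the twisted group ring, over the ring of sections. -/
structure SectionBasis (𝒜 : GAlgebraBundle G X A) (M : Type u) [AddCommGroup M]
    [Module 𝒜.crossedProduct M] (ι : Type u) [Fintype ι] where
  gen : ι → M
  coord : ι → M →+ 𝒜.toAlgebraBundle.sections
  coord_smul : ∀ i (b : 𝒜.toAlgebraBundle.sections) m,
    coord i ((SkewMonoidAlgebra.single 1 b : 𝒜.crossedProduct) • m) = b * coord i m
  sum_coord : ∀ m, ∑ i, (SkewMonoidAlgebra.single 1 (coord i m) : 𝒜.crossedProduct) • gen i = m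

-- `B ⋊ G` is free over `B` on the finite set `G`. A dual basis over `B ⋊ G` thus yields one over
-- `B`: the generators are multiplied by all `g`, and the coordinates are the coefficients at `g`.
open Classical in
theorem exists_sectionBasis [Finite G] {M : Type u} [AddCommGroup M] [Module 𝒜.crossedProduct M]
    [Module.Finite 𝒜.crossedProduct M] [Module.Projective 𝒜.crossedProduct M] :
    ∃ (ι : Type u) (_ : Fintype ι), Nonempty (SectionBasis 𝒜 M ι) := by
  have := Fintype.ofFinite G
  obtain ⟨n, π, σ, -, -, hπσ⟩ :=
    Module.Finite.exists_comp_eq_id_of_projective 𝒜.crossedProduct M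
  refine ⟨G × ULift (Fin n), inferInstance, ⟨{
    gen := fun i => (SkewMonoidAlgebra.single i.1 1 : 𝒜.crossedProduct) •
      π (Pi.single i.2.down 1)
    coord := fun i =>
      { toFun := fun m => (σ m i.2.down).coeff i.1
        map_zero' := by simp
        map_add' := fun m m' => by
          rw [map_add, Pi.add_apply, SkewMonoidAlgebra.coeff_add, Finsupp.add_apply] }
    coord_smul := fun i b m => by
      change (σ (_ • m) i.2.down).coeff i.1 = _
      rw [map_smul, Pi.smul_apply, smul_eq_mul, SkewMonoidAlgebra.coeff_single_one_mul]
      rfl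
    sum_coord := fun m => ?_ }⟩⟩
  have h1 : ∀ r : 𝒜.crossedProduct,
      ∑ g : G, (SkewMonoidAlgebra.single g (r.coeff g) : 𝒜.crossedProduct) = r := by
    intro r
    conv_rhs => rw [← SkewMonoidAlgebra.sum_single r]
    rw [SkewMonoidAlgebra.sum_def, Finsupp.sum_fintype]
    simp
  rw [Fintype.sum_prod_type_right]
  calc _ = ∑ j : ULift (Fin n), σ m j.down • π (Pi.single j.down 1) := by
        refine Finset.sum_congr rfl fun j _ => ?_
        rw [← h1 (σ m j.down), Finset.sum_smul]
        refine Finset.sum_congr rfl fun g _ => ?_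
        exact (smul_smul _ _ _).trans
          (congrArg (· • π _) (GAlgebraBundle.single_one_mul_single g _))
    _ = ∑ j : Fin n, σ m j • π (Pi.single j 1) :=
        Equiv.ulift.sum_comp fun j : Fin n => σ m j • π (Pi.single j 1)
    _ = π (σ m) := by
        simp_rw [← map_smul]
        rw [← map_sum]
        congr 1
        ext j
        simp [Finset.sum_apply, Pi.single_apply]
    _ = m := DFunLike.congr_fun hπσ m

namespace SectionBasis

variable {M : Type u} [AddCommGroup M] [Module 𝒜.crossedProduct M] {ι : Type u} [Fintype ι]
  (β : SectionBasis 𝒜 M ι)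

/-- Expanding `m` in the generators and moving `g` past the coefficients by `g * b = g(b) * g` shows
that `g` acts on coordinate rows by `v ↦ g(v) P(g)`, where `P` is `actMatrix`. -/
theorem coord_group_smul (g : G) (m : M) (c : ι) :
    β.coord c ((SkewMonoidAlgebra.single g 1 : 𝒜.crossedProduct) • m) =
      ∑ i, (g • β.coord i m) *
        β.coord c ((SkewMonoidAlgebra.single g 1 : 𝒜.crossedProduct) • β.gen i) := by
  conv_lhs => rw [← β.sum_coord m, Finset.smul_sum, map_sum]
  refine Finset.sum_congr rfl fun i _ => ?_
  rw [← β.coord_smul, smul_smul, smul_smul, GAlgebraBundle.single_mul_single_one,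
    GAlgebraBundle.single_one_mul_single]

/-- The matrix of the action of `g`. -/
noncomputable def actMatrix (g : G) : Matrix ι ι 𝒜.toAlgebraBundle.sections := fun a b =>
  β.coord b ((SkewMonoidAlgebra.single g 1 : 𝒜.crossedProduct) • β.gen a)

/-- This is the cocycle identity `h(P(g)) P(h) = P(hg)`, obtained by applying `coord_group_smul` to
`g • gen a`. It makes `P(1)` idempotent and the fiberwise formula an action. -/
theorem map_smul_mul_actMatrix (g h : G) :
    (β.actMatrix g).map (h • ·) * β.actMatrix h = β.actMatrix (h * g) := by
  ext1 a c
  rw [Matrix.mul_apply]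
  refine (β.coord_group_smul h _ c).symm.trans ?_
  rw [smul_smul, GAlgebraBundle.single_mul_single_group]
  rfl

theorem actMatrix_mul_actMatrix_one (g : G) :
    β.actMatrix g * β.actMatrix 1 = β.actMatrix g := by
  have := β.map_smul_mul_actMatrix g 1
  rw [one_mul] at this
  conv_rhs => rw [← this]
  congr 1
  ext1 a b
  simp

theorem act_vecMul (g : G) {x y : X} (h : g • x = y) (v : ι → 𝒜.fiber x)
    (P : Matrix ι ι 𝒜.toAlgebraBundle.sections) :
    (fun a => 𝒜.act g h ((v ᵥ* P.map (𝒜.evalHom x)) a)) =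
      (fun a => 𝒜.act g h (v a)) ᵥ* (P.map (g • ·)).map (𝒜.evalHom y) := by
  funext b
  simp only [Matrix.vecMul, dotProduct, map_sum, map_mul, Matrix.map_apply]
  refine Finset.sum_congr rfl fun a _ => ?_
  congr 1
  exact (GAlgebraBundle.smul_section_apply g (P a b) h).symm

variable [CompleteSpace A]

/-- The bundle associated with a finitely generated projective module. -/
noncomputable def bundle : GModuleBundle 𝒜 where
  toModuleBundle := 𝒜.imageBundle (β.actMatrix_mul_actMatrix_one 1)
  act g x y h :=
    { toFun := fun v => ⟨(fun a => 𝒜.act g h (v.1 a)) ᵥ* (β.actMatrix g).map (𝒜.evalHom y), by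
        rw [mem_fixedRows, Matrix.vecMul_vecMul, ← Matrix.map_mul, actMatrix_mul_actMatrix_one]⟩
      map_zero' := Subtype.ext <| by
        refine Eq.trans ?_ (Matrix.zero_vecMul ((β.actMatrix g).map (𝒜.evalHom y)))
        exact congrArg (· ᵥ* _) (funext fun a => map_zero (𝒜.act g h))
      map_add' := fun v w => Subtype.ext <| by
        refine Eq.trans ?_ (Matrix.add_vecMul ((β.actMatrix g).map (𝒜.evalHom y)) _ _)
        exact congrArg (· ᵥ* _) (funext fun a => map_add (𝒜.act g h) (v.1 a) (w.1 a)) }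
  act_one {x} v := Subtype.ext <| by
    refine Eq.trans ?_ v.2
    exact congrArg (· ᵥ* _) (funext fun a => 𝒜.act_one (v.1 a))
  act_mul g h x y z hxy hyz v := Subtype.ext <| by
    change (fun a => 𝒜.act (g * h) _ (v.1 a)) ᵥ* (β.actMatrix (g * h)).map (𝒜.evalHom z) =
      (fun a => 𝒜.act g hyz (((fun a => 𝒜.act h hxy (v.1 a)) ᵥ*
        (β.actMatrix h).map (𝒜.evalHom y)) a)) ᵥ* (β.actMatrix g).map (𝒜.evalHom z)
    rw [act_vecMul, Matrix.vecMul_vecMul, ← Matrix.map_mul, map_smul_mul_actMatrix]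
    exact congrArg (· ᵥ* _) (funext fun a => 𝒜.act_mul g h hxy hyz (v.1 a))
  act_smul g x y h c v := Subtype.ext <| by
    refine Eq.trans ?_ (Matrix.smul_vecMul (𝒜.act g h c) _ ((β.actMatrix g).map (𝒜.evalHom y)))
    exact congrArg (· ᵥ* _) (funext fun a => map_mul (𝒜.act g h) c (v.1 a))
  continuous_act g := by
    have hb : Continuous fun q : Σ x, 𝒜.imageFiber (β.actMatrix 1) x => g • q.1 :=
      (continuous_const_smul g).comp 𝒜.continuous_image_fst
    refine 𝒜.continuous_image_iff.2 ⟨hb, fun b => ?_⟩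
    refine 𝒜.self.continuous_sum (Y := Σ x, 𝒜.imageFiber (β.actMatrix 1) x) Finset.univ hb
      fun a _ => ?_
    exact 𝒜.continuous_mul (Y := Σ x, 𝒜.imageFiber (β.actMatrix 1) x) hb
      ((𝒜.continuous_act g).comp (𝒜.continuous_image_apply a)) ((β.actMatrix g a b).2.comp hb)

theorem bundle_smul_apply (g : G) (s : β.bundle.toModuleBundle.sections) (x : X) :
    ((g • s).1 x).1 = (fun a => 𝒜.act g (smul_inv_smul g x) ((s.1 (g⁻¹ • x)).1 a)) ᵥ*
      (β.actMatrix g).map (𝒜.evalHom x) := rfl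

/-- The coordinates of an element of the module form a section of the associated bundle. -/
noncomputable def toSection : M →ₗ[𝒜.crossedProduct] β.bundle.toModuleBundle.sections :=
  let φ : M →+ β.bundle.toModuleBundle.sections :=
    { toFun := fun m => ⟨fun x => ⟨fun a => (β.coord a m).1 x, by
          -- The case `g = 1` of `coord_group_smul`: coordinate rows are fixed by `P(1)`.
          have key : ∀ c, ∑ i, β.coord i m * β.actMatrix 1 i c = β.coord c m := fun c => by
            have := β.coord_group_smul 1 m c
            rw [SkewMonoidAlgebra.single_one_one, one_smul] at this
            simpa [actMatrix, SkewMonoidAlgebra.single_one_one] using this.symm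
          funext c
          have := congrArg (𝒜.evalHom x) (key c)
          simpa [Matrix.vecMul, dotProduct] using this⟩,
        𝒜.continuous_image_iff.2 ⟨continuous_id, fun a => (β.coord a m).2⟩⟩
      map_zero' := Subtype.ext <| funext fun x => Subtype.ext <| funext fun a =>
        congrArg (𝒜.evalHom x) (map_zero (β.coord a))
      map_add' := fun m m' => Subtype.ext <| funext fun x => Subtype.ext <| funext fun a =>
        congrArg (𝒜.evalHom x) (map_add (β.coord a) m m') }
  { φ with
    map_smul' := fun r m => by
      change φ (r • m) = r • φ m
      induction r using SkewMonoidAlgebra.induction_on with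
      | zero =>
        exact ((congrArg φ (zero_smul 𝒜.crossedProduct m)).trans (map_zero φ)).trans
          (zero_smul 𝒜.crossedProduct (φ m)).symm
      | single g b =>
        rw [GModuleBundle.single_smul]
        refine Subtype.ext <| funext fun x => Subtype.ext <| funext fun c => ?_
        have h1 : (SkewMonoidAlgebra.single g b : 𝒜.crossedProduct) • m =
            (SkewMonoidAlgebra.single 1 b : 𝒜.crossedProduct) •
              (SkewMonoidAlgebra.single g 1 : 𝒜.crossedProduct) • m := by
          rw [smul_smul, GAlgebraBundle.single_one_mul_single]
        have h2 : β.coord c ((SkewMonoidAlgebra.single g b : 𝒜.crossedProduct) • m) =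
            b * ∑ i, (g • β.coord i m) * β.actMatrix g i c := by
          rw [h1, β.coord_smul, β.coord_group_smul]
          rfl
        refine (congrArg (𝒜.evalHom x) h2).trans ?_
        rw [map_mul, map_sum]
        refine congrArg (b.1 x * ·) ?_
        refine Eq.trans ?_ (congrFun (β.bundle_smul_apply g (φ m) x) c).symm
        exact Finset.sum_congr rfl fun i _ => map_mul (𝒜.evalHom x) _ _
      | add r r' h h' => rw [add_smul, add_smul, map_add, h, h'] }

theorem toSection_apply (m : M) (x : X) (a : ι) :
    ((β.toSection m).1 x).1 a = (β.coord a m).1 x := rfl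

/-- An element is determined by its coordinates. Conversely, a section has a row `c` of coordinates
in `B`, and the element `∑ a, c a • gen a` has coordinates `c P(1)`, which is `c` because the
section lies in the fixed rows. -/
theorem toSection_bijective : Function.Bijective β.toSection := by
  constructor
  · refine (injective_iff_map_eq_zero _).2 fun m hm => ?_
    have h : ∀ a, β.coord a m = 0 := fun a => Subtype.ext <| funext fun x => by
      rw [← toSection_apply, hm]
      rfl
    rw [← β.sum_coord m]
    refine Finset.sum_eq_zero fun a _ => ?_
    rw [h, SkewMonoidAlgebra.single_zero]
    exact zero_smul 𝒜.crossedProduct (β.gen a)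
  · intro s
    let c : ι → 𝒜.toAlgebraBundle.sections := fun a =>
      ⟨fun x => (s.1 x).1 a, (𝒜.continuous_image_iff.1 s.2).2 a⟩
    refine ⟨∑ a, (SkewMonoidAlgebra.single 1 (c a) : 𝒜.crossedProduct) • β.gen a, ?_⟩
    refine Subtype.ext <| funext fun x => Subtype.ext <| funext fun b => ?_
    rw [toSection_apply, map_sum]
    simp_rw [β.coord_smul]
    have h := congrFun (s.1 x).2 b
    refine Eq.trans ?_ h
    refine (map_sum (𝒜.evalHom x) _ _).trans (Finset.sum_congr rfl fun a _ => ?_)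
    rw [map_mul]
    simp only [Matrix.map_apply, actMatrix, SkewMonoidAlgebra.single_one_one, one_smul]
    rfl

end SectionBasis

theorem sectionsFunctor_lift_essSurj [Finite G] [CompleteSpace A]
    (hΓ : ∀ E : GModuleBundle 𝒜, fgProjective 𝒜.crossedProduct ((sectionsFunctor 𝒜).obj E)) :
    ((fgProjective 𝒜.crossedProduct).lift (sectionsFunctor 𝒜) hΓ).EssSurj where
  mem_essImage M := by
    have := M.property.1
    have := M.property.2
    obtain ⟨ι, _, ⟨β⟩⟩ := exists_sectionBasis (𝒜 := 𝒜) (M := M.obj)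
    refine ⟨β.bundle, ⟨(fgProjective 𝒜.crossedProduct).fullyFaithfulι.preimageIso ?_⟩⟩
    exact (LinearEquiv.ofBijective β.toSection β.toSection_bijective).symm.toModuleIso

end EssSurj

/-! ### Functoriality of Grothendieck groups -/

namespace GrothendieckGroup

open Limits

universe v v' w w'

variable {C : Type w} [Category.{v} C] [Preadditive C] {D : Type w'} [Category.{v'} D]
  [Preadditive D]

theorem mk_pt {P Q : C} {b : BinaryBicone P Q} (hb : b.IsBilimit) :
    mk b.pt = mk P + mk Q := by
  refine (QuotientAddGroup.eq_iff_sub_mem (N := directSumRelations C)).2 ?_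
  exact AddSubgroup.subset_closure ⟨P, Q, b, ⟨hb⟩, rfl⟩

/-- `Q` is itself a direct sum of `P` and `Z`. Taking `P = Q = Z` gives `mk Z = 0`, so classes are
invariant under isomorphism. -/
theorem mk_add_mk_of_iso {P Q Z : C} (hZ : IsZero Z) (e : P ≅ Q) : mk Q = mk P + mk Z := by
  let b : BinaryBicone P Z :=
    { pt := Q
      fst := e.inv
      snd := 0
      inl := e.hom
      inr := 0
      inr_snd := hZ.eq_of_src _ _ }
  exact mk_pt (b := b) (isBinaryBilimitOfTotal b (by simp [b]))

theorem mk_eq_of_iso [HasZeroObject C] {P Q : C} (e : P ≅ Q) : mk P = mk Q := by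
  obtain ⟨Z, hZ⟩ := HasZeroObject.zero (C := C)
  have h0 : mk Z = 0 := left_eq_add.1 (mk_add_mk_of_iso hZ (Iso.refl Z))
  rw [mk_add_mk_of_iso hZ e, h0, add_zero]

/-- The homomorphism of Grothendieck groups induced by an additive functor. -/
def map (F : C ⥤ D) [F.Additive] : GrothendieckGroup C →+ GrothendieckGroup D :=
  QuotientAddGroup.lift (directSumRelations C)
    (FreeAbelianGroup.lift fun P => mk (F.obj P)) <| by
    refine (AddSubgroup.closure_le _).2 ?_
    rintro _ ⟨P, Q, b, ⟨hb⟩, rfl⟩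
    have htotal : F.map b.fst ≫ F.map b.inl + F.map b.snd ≫ F.map b.inr = 𝟙 (F.obj b.pt) := by
      rw [← F.map_comp, ← F.map_comp, ← F.map_add, IsBilimit.binary_total hb, F.map_id]
    have h := mk_pt (isBinaryBilimitOfTotal (F.mapBinaryBicone b) htotal)
    change FreeAbelianGroup.lift _ _ = 0
    rw [map_sub, map_add, FreeAbelianGroup.lift_apply_of, FreeAbelianGroup.lift_apply_of,
      FreeAbelianGroup.lift_apply_of, sub_eq_zero]
    exact h

@[simp]
theorem map_mk (F : C ⥤ D) [F.Additive] (P : C) : map F (mk P) = mk (F.obj P) :=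
  FreeAbelianGroup.lift_apply_of _ _

theorem hom_ext {H : Type*} [AddCommGroup H] {f g : GrothendieckGroup C →+ H}
    (h : ∀ P, f (mk P) = g (mk P)) : f = g :=
  QuotientAddGroup.addMonoidHom_ext _ (FreeAbelianGroup.lift_ext _ _ h)

/-- An additive equivalence induces an isomorphism of Grothendieck groups. -/
def equivOfEquivalence [HasZeroObject C] [HasZeroObject D] (e : C ≌ D) [e.functor.Additive] :
    GrothendieckGroup C ≃+ GrothendieckGroup D :=
  (map e.functor).toAddEquiv (map e.inverse)
    (hom_ext fun P => by simpa using mk_eq_of_iso (e.unitIso.app P).symm)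
    (hom_ext fun P => by simpa using mk_eq_of_iso (e.counitIso.app P))

@[simp]
theorem equivOfEquivalence_mk [HasZeroObject C] [HasZeroObject D] (e : C ≌ D)
    [e.functor.Additive] (P : C) : equivOfEquivalence e (mk P) = mk (e.functor.obj P) :=
  map_mk _ _

end GrothendieckGroup

theorem hasZeroObject_fgProjective (R : Type u) [Ring R] :
    Limits.HasZeroObject (fgProjective R).FullSubcategory := by
  have h : fgProjective R (ModuleCat.of R PUnit.{u + 1}) :=
    ⟨inferInstanceAs (Module.Finite R PUnit.{u + 1}),
      inferInstanceAs (Module.Projective R PUnit.{u + 1})⟩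
  let Z : (fgProjective R).FullSubcategory :=
    ⟨ModuleCat.of R PUnit, h⟩
  refine ⟨⟨Z, (Limits.IsZero.iff_id_eq_zero Z).2 ?_⟩⟩
  exact (fgProjective R).ι.map_injective
    ((ModuleCat.isZero_of_subsingleton (ModuleCat.of R PUnit)).eq_of_src _ _)

end TwistedK

open TwistedK
theorem theoremK {G X A : Type u} [Group G] [Finite G]
    [TopologicalSpace X] [CompactSpace X] [T2Space X]
    [MulAction G X] [ContinuousConstSMul G X]
    [NormedRing A] [NormedAlgebra ℝ A] [CompleteSpace A]
    (𝒜 : GAlgebraBundle G X A) :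
    ∃ hΓ : ∀ E : GModuleBundle 𝒜,
        fgProjective 𝒜.crossedProduct ((sectionsFunctor 𝒜).obj E),
      ((fgProjective 𝒜.crossedProduct).lift (sectionsFunctor 𝒜) hΓ).IsEquivalence ∧
      ∃ φ : equivariantK 𝒜 ≃+ K₀ 𝒜.crossedProduct,
        ∀ E : GModuleBundle 𝒜, φ (GrothendieckGroup.mk E) =
          GrothendieckGroup.mk
            (((fgProjective 𝒜.crossedProduct).lift (sectionsFunctor 𝒜) hΓ).obj E) := by
  let hΓ := fun E : GModuleBundle 𝒜 => E.fgProjective_sections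
  let F := (fgProjective 𝒜.crossedProduct).lift (sectionsFunctor 𝒜) hΓ
  have : F.EssSurj := sectionsFunctor_lift_essSurj hΓ
  -- Fullness and faithfulness are inherited from `sectionsFunctor`.
  have hF : F.IsEquivalence := {}
  have hadd : F.Additive := { map_add := rfl }
  have : F.asEquivalence.functor.Additive := hadd
  have := hasZeroObject_fgProjective 𝒜.crossedProduct
  obtain ⟨Z, hZ⟩ := Limits.HasZeroObject.zero (C := (fgProjective 𝒜.crossedProduct).FullSubcategory)
  -- The zero bundle is obtained from the zero module through the inverse equivalence.
  have : Limits.HasZeroObject (GModuleBundle 𝒜) :=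
    ⟨⟨F.asEquivalence.inverse.obj Z, F.asEquivalence.inverse.map_isZero hZ⟩⟩
  exact ⟨hΓ, hF, GrothendieckGroup.equivOfEquivalence F.asEquivalence,
    fun E => GrothendieckGroup.equivOfEquivalence_mk F.asEquivalence E⟩
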